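/- Let $C(t)=\sum_k |a_k|^2 e^{i\omega_k t}$ be a signal with distinct real frequencies $\omega_k$ (finitely or infinitely many) such that $\sum_k |a_k|^2<\infty$ and $\sum_k|\omega_k||a_k|^2<\infty$. Let $W,T>0$, $\omega^*\in\mathbb R$, let $B=[\omega^*-W,\omega^*+W]$, and suppose that exactly $m$ frequencies, $1\le m<\infty$, lie in $B$. Let $\rho_W(x)=\frac{\sin Wx}{\pi x}$, and let $(\xi_n)_{n\ge0}$ be the $WT$-prolates: the real eigenfunctions, orthonormal in $L^2(\mathbb R)$ and complete in $L^2([-T,T])$, of the integral equation $\int_{-T}^{T}\rho_W(s-t)\xi_n(t)\,dt=\gamma_n\xi_n(s)$, $s\in\mathbb R$, ordered so that $\gamma_0\ge\gamma_1\ge\dots>0$. Let $\tilde\xi_n(\omega)=\sqrt{T/W}\,\xi_n(T\omega/W)$ be the dual prolates and let $\lambda_n$ be the eigenvalue in the prolate differential equation $$(W^2-\omega^2)\tilde\xi_n''(\omega)-2\omega\tilde\xi_n'(\omega)+T^2(W^2-\omega^2)\tilde\xi_n(\omega)=-\lambda_n\tilde\xi_n(\omega),\qquad \omega\in\mathbb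 R .$$ Put $$C_{\mathrm{extra},n}=\sqrt{\|\tilde\xi_n'\|_{L^2(\mathbb R)}^2-\frac{\lambda_n}{W}\,\frac{\tilde\xi_n(W)^2}{1-\gamma_n}},\qquad \tilde\varepsilon_M=2\pi\sum_{l=0}^{M-1}\gamma_l(1-\gamma_l)\,C_{\mathrm{extra},l}.$$ For $M\ge m$ form, from the values of $C$ on $[-2T,2T]$, the $M\times M$ matrices ($0\le s,l<M$) $$(\mathbf V^2_M)_{sl}=\int_{-T}^{T}\!\int_{-T}^{T}e^{-i\omega^*(\tau-t)}\xi_s(\tau)\xi_l(t)\,C(\tau-t)\,d\tau\,dt,$$ $$(\mathbf H_{V_M})_{sl}=i\int_{-T}^{T}\!\int_{-T}^{T}e^{-i\omega^*(\tau-t)}\xi_s(\tau)\xi_l(t)\,\partial_tC(\tau-t)\,d\tau\,dt .$$ Choose a unitary $\mathbf U$ with $\mathbf U^\dagger\mathbf V_M^2\mathbf U=\operatorname{diag}(\lambda_1(\mathbf V_M^2),\dots,\lambda_M(\mathbf V_M^2))$, eigenvalues in decreasing order, and let $\mathbf V_*^2=\operatorname{diag}(\lambda_1(\mathbf V_M^2),\dots,\lambda_m(\mathbf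 V_M^2))$ and $\mathbf H_{V_*}$ be the leading $m\times m$ block of $\mathbf U^\dagger\mathbf H_{V_M}\mathbf U$. Assume that $\lambda_m(\mathbf V_M^2)>\tilde\varepsilon_M\,C(0)$. Let $\tilde\omega_1\ge\dots\ge\tilde\omega_m$ be the eigenvalues, counted with multiplicity, of the generalized eigenvalue problem $\mathbf H_{V_*}x=\tilde\omega\,\mathbf V_*^2x$, and let $\omega_1>\dots>\omega_m$ denote the frequencies of $C$ in $B$. Then for every $k=1,\dots,m$ $$\tilde\varepsilon_M\,\frac{\sum_{\omega_l<\omega^*-W}(\omega_l-\omega_k)|a_l|^2}{\lambda_m(\mathbf V_M^2)-\tilde\varepsilon_M C(0)}\;\le\;\tilde\omega_k-\omega_k\;\le\;\tilde\varepsilon_M\,\frac{\sum_{\omega_l>\omega^*+W}(\omega_l-\omega_k)|a_l|^2}{\lambda_m(\mathbf V_M^2)-\tilde\varepsilon_M C(0)} ,$$ where the sums run over all frequencies $\omega_l$ of the signal in the indicated range. -/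

import Mathlib

open MeasureTheory

noncomputable section

namespace PFD

/-- The sampling kernel `ρ_W(x) = sin(W x) / (π x)`, with `ρ_W(0) = W / π`. -/
def rho (W x : ℝ) : ℝ := W / Real.pi * Real.sinc (W * x)

/-- `ξ` is the sequence of `W T`-prolates and `γ` the sequence of their eigenvalues: the `ξ n` are
the eigenfunctions of `f ↦ ∫_{-T}^{T} ρ_W(· - t) f(t) dt` with nonzero eigenvalue, listed by
decreasing eigenvalue and normalized over the whole real line; the list is complete. -/
structure IsProlateSequence (W T : ℝ) (γ : ℕ → ℝ) (ξ : ℕ → ℝ → ℝ) : Prop where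
  memLp : ∀ n, MemLp (ξ n) 2 volume
  eigen : ∀ n s, ∫ t in (-T)..T, rho W (s - t) * ξ n t = γ n * ξ n s
  pos : ∀ n, 0 < γ n
  anti : Antitone γ
  orthonormal : ∀ n k, ∫ t, ξ n t * ξ k t = if n = k then 1 else 0
  complete : ∀ f : ℝ → ℝ, MemLp f 2 (volume.restrict (Set.Icc (-T) T)) →
    (∀ n, ∫ t in (-T)..T, f t * ξ n t = 0) → f =ᵐ[volume.restrict (Set.Icc (-T) T)] 0

/-- The prolate spheroidal differential operator
`f ↦ (T² - t²) f'' - 2 t f' + W² (T² - t²) f`. -/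
def spheroidalOp (W T : ℝ) (f : ℝ → ℝ) (t : ℝ) : ℝ :=
  (T ^ 2 - t ^ 2) * deriv (deriv f) t - 2 * t * deriv f t + W ^ 2 * (T ^ 2 - t ^ 2) * f t

/-- The number `lam` with `spheroidalOp W T f = -lam • f`. -/
def spheroidalEigenvalue (W T : ℝ) (f : ℝ → ℝ) : ℝ :=
  Classical.epsilon fun lam : ℝ => ∀ t, spheroidalOp W T f t = -lam * f t

/-- The constant `C_extra = √(‖f'‖² - (lam / T) f(T)² / (1 - g))` of a `W T`-prolate `f` with
eigenvalue `g`, where `‖·‖` is the `L²` norm over the real line. -/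
def cExtra (W T g : ℝ) (f : ℝ → ℝ) : ℝ :=
  Real.sqrt ((∫ t, deriv f t ^ 2) - spheroidalEigenvalue W T f / T * (f T ^ 2 / (1 - g)))

/-- The dual prolate `ξ̃(w) = √(T / W) ξ(T w / W)`, which is a prolate with the roles of `W` and
`T` exchanged (frequency-concentrated on `[-W, W]`). -/
def dual (W T : ℝ) (f : ℝ → ℝ) (w : ℝ) : ℝ := Real.sqrt (T / W) * f (T / W * w)

/-- `ε̃_M = 2π ∑_{l < M} γ_l (1 - γ_l) C_{extra,l}`. The constant `C_{extra,l}` is that of the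
dual prolate, which is concentrated on `[-W, W]`: this is where `T` and `W` are exchanged. -/
def epsTilde (W T : ℝ) (γ : ℕ → ℝ) (ξ : ℕ → ℝ → ℝ) (M : ℕ) : ℝ :=
  2 * Real.pi * ∑ l ∈ Finset.range M, γ l * (1 - γ l) * cExtra T W (γ l) (dual W T (ξ l))

/-- The signal `C(t) = ∑_k |a_k|² e^{i ω_k t}`. -/
def signal {ι : Type*} (a : ι → ℂ) (ω : ι → ℝ) (t : ℝ) : ℂ :=
  ∑' k, ((‖a k‖ ^ 2 : ℝ) : ℂ) * Complex.exp (Complex.I * ω k * t)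

/-- The Gram matrix `V²_M` computed from a signal `C` with filter centre `ωs`. -/
def gramMatrix (T ωs : ℝ) (ξ : ℕ → ℝ → ℝ) (C : ℝ → ℂ) (M : ℕ) : Matrix (Fin M) (Fin M) ℂ :=
  Matrix.of fun s l => ∫ t in (-T)..T, ∫ τ in (-T)..T,
    Complex.exp (-Complex.I * ωs * (τ - t)) * ξ s τ * ξ l t * C (τ - t)

/-- The matrix `H_{V_M}` computed from a signal `C` with filter centre `ωs`; the derivative is
the one of `t ↦ C(τ - t)`. -/
def hamMatrix (T ωs : ℝ) (ξ : ℕ → ℝ → ℝ) (C : ℝ → ℂ) (M : ℕ) : Matrix (Fin M) (Fin M) ℂ :=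
  Matrix.of fun s l => Complex.I * ∫ t in (-T)..T, ∫ τ in (-T)..T,
    Complex.exp (-Complex.I * ωs * (τ - t)) * ξ s τ * ξ l t * deriv (fun u : ℝ => C (τ - u)) t

/-- `lam` lists the eigenvalues of `V2` in decreasing order, diagonalized by the unitary `U`. -/
def Diagonalizes {M : ℕ} (V2 U : Matrix (Fin M) (Fin M) ℂ) (lam : Fin M → ℝ) : Prop :=
  U ∈ Matrix.unitaryGroup (Fin M) ℂ ∧ Antitone lam ∧
    U.conjTranspose * V2 * U = Matrix.diagonal fun j => (lam j : ℂ)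

/-- The refined Gram matrix `diag(lam_1, …, lam_m)`. -/
def refinedGram {M m : ℕ} (h : m ≤ M) (lam : Fin M → ℝ) : Matrix (Fin m) (Fin m) ℂ :=
  Matrix.diagonal fun i => (lam (Fin.castLE h i) : ℂ)

/-- The refined matrix: the leading `m × m` block of `U† H U`. -/
def refinedHam {M m : ℕ} (h : m ≤ M) (U H : Matrix (Fin M) (Fin M) ℂ) :
    Matrix (Fin m) (Fin m) ℂ :=
  (U.conjTranspose * H * U).submatrix (Fin.castLE h) (Fin.castLE h)

/-- `μ` lists, with multiplicity and in decreasing order, the eigenvalues of the generalized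
eigenvalue problem `A x = μ B x`. -/
def IsGEPEigenvalues {m : ℕ} (A B : Matrix (Fin m) (Fin m) ℂ) (μ : Fin m → ℝ) : Prop :=
  Antitone μ ∧ ∃ Φ : Matrix (Fin m) (Fin m) ℂ, Φ.conjTranspose * B * Φ = 1 ∧
    A * Φ = B * Φ * Matrix.diagonal fun i => (μ i : ℂ)

end PFD

end

/-! ### Calculus of the finite Fourier transform and its commuting differential operator. -/

noncomputable section

namespace PFD

open Complex Set Filter Topology intervalIntegral
open scoped ContDiff

/-! Let `v_k` be the vector of transforms, at frequency `ω_k - ω*`, of the first `M` prolates cut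
off to `[-T, T]`. Then `V² = ∑ |a_k|² v_k v_k†` and `H = ∑ ω_k |a_k|² v_k v_k†`
(`hasSum_gramMatrix`, `hasSum_hamMatrix`), and the error comes only from the frequencies outside the
band, for which `‖v_k‖² ≤ ε̃_M`.

The comparison is a minimax argument (`gep_eigenvalue_sub_le`). By a dimension count, some nonzero
`y` in the span of the generalized eigenvectors of `ω̃_1, …, ω̃_i` is orthogonal to the `v_k` of the
`i - 1` band frequencies above `ω_i`. Its Rayleigh quotient is at least `ω̃_i`. Its excess over
`ω_i` has positive contributions only from frequencies above the band, each weighted by `|v_k† y|² ≤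
ε̃_M ‖y‖²`, while `y† V² y ≥ λ_m ‖y‖²`. The lower bound is symmetric. The denominator obtained is
`λ_m`, which implies the stated bound.

The estimate of `‖v_k‖²` is `IsProlate.sq_le_cExtra`, applied to the dual prolates. Agmon's
inequality bounds `f(s)²` outside `[-T, T]` by the tail norms of `f` and `f'`, and both tails are
known exactly: Plancherel evaluates `∫ f²` on `[-T, T]`, and integration by parts with the
differential equation at the endpoints evaluates `∫ f'²`. This uses that a prolate is an
eigenfunction of the finite Fourier transform `F`, has a parity and solves the differential
equation. All three hold because `F`, reflection and the differential operator preserve the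
eigenspaces of `F F*`, which are one-dimensional (`IsFourierEigen.exists_eq_const_mul`). -/

/-- The finite Fourier transform `f ↦ ∫_{-T}^{T} e^{iκst} f(t) dt`. -/
def finFourier (κ T : ℝ) (f : ℝ → ℂ) (s : ℝ) : ℂ :=
  ∫ t in (-T)..T, cexp ((κ * s * t : ℝ) * I) * f t

lemma hasDerivAt_expKernel_left (κ s t : ℝ) :
    HasDerivAt (fun s : ℝ => cexp ((κ * s * t : ℝ) * I))
      (cexp ((κ * s * t : ℝ) * I) * (I * κ * t)) s := by
  have h1 : HasDerivAt (fun s : ℝ => κ * s * t) (κ * t) s := by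
    simpa using ((hasDerivAt_id s).const_mul κ).mul_const t
  convert! (h1.ofReal_comp.mul_const I).cexp using 1
  push_cast
  ring

lemma hasDerivAt_expKernel_right (κ s t : ℝ) :
    HasDerivAt (fun t : ℝ => cexp ((κ * s * t : ℝ) * I))
      (cexp ((κ * s * t : ℝ) * I) * (I * κ * s)) t := by
  have h1 : HasDerivAt (fun t : ℝ => κ * s * t) (κ * s) t := by
    simpa using (hasDerivAt_id t).const_mul (κ * s)
  convert! (h1.ofReal_comp.mul_const I).cexp using 1
  push_cast
  ring

lemma intervalIntegrable_expKernel_mul {f : ℝ → ℂ} {a b : ℝ} (κ s : ℝ)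
    (hf : IntervalIntegrable f volume a b) :
    IntervalIntegrable (fun t => cexp ((κ * s * t : ℝ) * I) * f t) volume a b :=
  hf.continuousOn_mul (by fun_prop)

lemma hasDerivAt_finFourier (κ T : ℝ) {f : ℝ → ℂ} (hf : IntervalIntegrable f volume (-T) T)
    (s : ℝ) :
    HasDerivAt (finFourier κ T f) (finFourier κ T (fun t => I * κ * t * f t) s) s := by
  have hM : IntervalIntegrable (fun t => I * κ * t * f t) volume (-T) T :=
    hf.continuousOn_mul (by fun_prop)
  refine (intervalIntegral.hasDerivAt_integral_of_dominated_loc_of_deriv_le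
    (bound := fun t => ‖I * κ * t * f t‖) (s := univ) univ_mem
    (F' := fun s t => cexp ((κ * s * t : ℝ) * I) * (I * κ * t * f t)) ?_ ?_ ?_ ?_ ?_ ?_).2
  · exact Eventually.of_forall fun x =>
      (intervalIntegrable_expKernel_mul κ x hf).aestronglyMeasurable_restrict_uIoc
  · exact intervalIntegrable_expKernel_mul κ s hf
  · exact (intervalIntegrable_expKernel_mul κ s hM).aestronglyMeasurable_restrict_uIoc
  · refine Eventually.of_forall fun t _ x _ => ?_
    rw [norm_mul, norm_exp_ofReal_mul_I, one_mul]
  · exact hM.norm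
  · refine Eventually.of_forall fun t _ x _ => ?_
    convert! (hasDerivAt_expKernel_left κ x t).mul_const (f t) using 1
    ring

lemma continuous_finFourier (κ T : ℝ) {f : ℝ → ℂ} (hf : IntervalIntegrable f volume (-T) T) :
    Continuous (finFourier κ T f) :=
  continuous_iff_continuousAt.2 fun s => (hasDerivAt_finFourier κ T hf s).continuousAt

lemma deriv_finFourier (κ T : ℝ) {f : ℝ → ℂ} (hf : Continuous f) :
    deriv (finFourier κ T f) = finFourier κ T (fun t => I * κ * t * f t) :=
  funext fun s => (hasDerivAt_finFourier κ T (hf.intervalIntegrable _ _) s).deriv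

lemma iteratedDeriv_finFourier (κ T : ℝ) {f : ℝ → ℂ} (hf : Continuous f) (n : ℕ) :
    iteratedDeriv n (finFourier κ T f) = finFourier κ T (fun t => (I * κ * t) ^ n * f t) := by
  induction n with
  | zero => simp
  | succ n ih =>
    rw [iteratedDeriv_succ, ih, deriv_finFourier κ T (by fun_prop)]
    congr 1
    ext t
    ring

lemma contDiff_finFourier (κ T : ℝ) {f : ℝ → ℂ} (hf : Continuous f) :
    ContDiff ℝ ∞ (finFourier κ T f) := by
  rw [contDiff_infty]
  intro n
  induction n generalizing f with
  | zero => exact contDiff_zero.2 (continuous_finFourier κ T (hf.intervalIntegrable _ _))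
  | succ n ih =>
    rw [Nat.cast_succ, contDiff_succ_iff_deriv]
    refine ⟨fun s => (hasDerivAt_finFourier κ T (hf.intervalIntegrable _ _) s).differentiableAt,
      by simp, ?_⟩
    rw [deriv_finFourier κ T hf]
    exact ih (by fun_prop)

lemma finFourier_comp_neg (κ T : ℝ) (f : ℝ → ℂ) (s : ℝ) :
    finFourier κ T (fun t => f (-t)) s = finFourier κ T f (-s) := by
  unfold finFourier
  simpa using integral_comp_neg (a := -T) (b := T)
    (fun t => cexp ((κ * -s * t : ℝ) * I) * f t)

lemma finFourier_const_mul (κ T : ℝ) (c : ℂ) (f : ℝ → ℂ) (s : ℝ) :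
    finFourier κ T (fun t => c * f t) s = c * finFourier κ T f s := by
  unfold finFourier
  rw [← intervalIntegral.integral_const_mul]
  congr 1; ext t; ring

lemma finFourier_sub (κ T : ℝ) {f g : ℝ → ℂ} (hf : Continuous f) (hg : Continuous g) (s : ℝ) :
    finFourier κ T (fun t => f t - g t) s = finFourier κ T f s - finFourier κ T g s := by
  unfold finFourier
  rw [← intervalIntegral.integral_sub
    (intervalIntegrable_expKernel_mul κ s (hf.intervalIntegrable _ _))
    (intervalIntegrable_expKernel_mul κ s (hg.intervalIntegrable _ _))]
  congr 1; ext t; ring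

lemma norm_finFourier_le (κ : ℝ) {T C : ℝ} (hT : 0 ≤ T) {f : ℝ → ℂ}
    (hf : ∀ t ∈ Icc (-T) T, ‖f t‖ ≤ C) (s : ℝ) : ‖finFourier κ T f s‖ ≤ C * (2 * T) := by
  unfold finFourier
  refine (intervalIntegral.norm_integral_le_of_norm_le_const (C := C) fun t ht => ?_).trans ?_
  · rw [norm_mul, norm_exp_ofReal_mul_I, one_mul]
    rw [uIoc_of_le (by linarith)] at ht
    exact hf t ⟨ht.1.le, ht.2⟩
  · rw [abs_of_nonneg (by linarith)]
    apply le_of_eq; ring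

/-- The kernel is symmetric in `s` and `t`, so Fubini applies. The pairing is bilinear, without
conjugation. -/
lemma integral_finFourier_mul (κ T : ℝ) {f g : ℝ → ℂ} (hf : Continuous f) (hg : Continuous g) :
    ∫ s in (-T)..T, finFourier κ T f s * g s = ∫ s in (-T)..T, f s * finFourier κ T g s := by
  unfold finFourier
  simp_rw [← intervalIntegral.integral_mul_const, ← intervalIntegral.integral_const_mul]
  rw [intervalIntegral_intervalIntegral_swap]
  · congr 1; ext t; congr 1; ext s
    rw [show κ * s * t = κ * t * s by ring]
    ring
  · refine (Continuous.continuousOn (by fun_prop)).integrableOn_compact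
      (isCompact_uIcc.prod isCompact_uIcc) |>.mono_set
      (prod_mono uIoc_subset_uIcc uIoc_subset_uIcc)

lemma finFourier_deriv (κ T : ℝ) {f : ℝ → ℂ} (hf : ContDiff ℝ 1 f) (s : ℝ) :
    finFourier κ T (deriv f) s = cexp ((κ * s * T : ℝ) * I) * f T
      - cexp ((κ * s * (-T) : ℝ) * I) * f (-T) - I * κ * s * finFourier κ T f s := by
  have hc : Continuous (deriv f) := hf.continuous_deriv le_rfl
  have h : ∀ t, HasDerivAt (fun t : ℝ => cexp ((κ * s * t : ℝ) * I) * f t)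
      (cexp ((κ * s * t : ℝ) * I) * deriv f t
        + (I * κ * s) * (cexp ((κ * s * t : ℝ) * I) * f t)) t := by
    intro t
    convert! (hasDerivAt_expKernel_right κ s t).mul
      (hf.differentiable one_ne_zero t).hasDerivAt using 1
    ring
  have hfc := hf.continuous
  have := integral_eq_sub_of_hasDerivAt (a := -T) (b := T) (fun t _ => h t)
    (Continuous.intervalIntegrable (by fun_prop) _ _)
  rw [intervalIntegral.integral_add (Continuous.intervalIntegrable (by fun_prop) _ _)
    (Continuous.intervalIntegrable (by fun_prop) _ _),
    intervalIntegral.integral_const_mul] at this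
  unfold finFourier
  rw [← this]
  ring

/-- The prolate differential operator on complex-valued functions, with `W = κ T`. -/
def prolateOp (κ T : ℝ) (f : ℝ → ℂ) (t : ℝ) : ℂ :=
  (T ^ 2 - t ^ 2) * deriv (deriv f) t - 2 * t * deriv f t + (κ * T) ^ 2 * (T ^ 2 - t ^ 2) * f t

lemma continuous_prolateOp (κ T : ℝ) {f : ℝ → ℂ} (hf : ContDiff ℝ 2 f) :
    Continuous (prolateOp κ T f) := by
  have h0 := hf.continuous
  have h1 : Continuous (deriv f) := hf.continuous_deriv (by norm_num)
  have h2 : Continuous (deriv (deriv f)) :=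
    ((contDiff_succ_iff_deriv (n := 1)).1 hf).2.2.continuous_deriv le_rfl
  unfold prolateOp
  fun_prop

lemma prolateOp_comp_neg (κ T : ℝ) (f : ℝ → ℂ) (t : ℝ) :
    prolateOp κ T (fun u => f (-u)) t = prolateOp κ T f (-t) := by
  have h1 : deriv (fun u => f (-u)) = fun u => -deriv f (-u) := by
    ext u; rw [deriv_comp_neg]
  have h2 : deriv (fun u => -deriv f (-u)) t = deriv (deriv f) (-t) := by
    rw [deriv.fun_neg, deriv_comp_neg, neg_neg]
  unfold prolateOp
  rw [h1, h2]
  push_cast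
  ring

lemma prolateOp_const_mul (κ T : ℝ) (c : ℂ) (f : ℝ → ℂ) (t : ℝ) :
    prolateOp κ T (fun u => c * f u) t = c * prolateOp κ T f t := by
  have h1 : deriv (fun u => c * f u) = fun u => c * deriv f u := by
    ext u; exact deriv_const_mul_field c
  unfold prolateOp
  rw [h1, deriv_const_mul_field]
  ring

/-- The prolate differential operator commutes with the finite Fourier transform. -/
lemma prolateOp_finFourier (κ T : ℝ) {f : ℝ → ℂ} (hf : ContDiff ℝ 2 f) (s : ℝ) :
    prolateOp κ T (finFourier κ T f) s = finFourier κ T (prolateOp κ T f) s := by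
  have h0 := hf.continuous
  have hd1 := ((contDiff_succ_iff_deriv (n := 1)).1 hf).2.2
  have h1 : Continuous (deriv f) := hf.continuous_deriv (by norm_num)
  have h2 : Continuous (deriv (deriv f)) := hd1.continuous_deriv le_rfl
  have hL := continuous_prolateOp κ T hf
  -- Lagrange's identity for `f` and the kernel. The factor `T² - t²` removes the boundary terms,
  -- and the operator acts on the kernel identically in `s` and in `t`.
  have hder : ∀ t, HasDerivAt
      (fun t : ℝ => ((T : ℂ) ^ 2 - (t : ℂ) ^ 2) * (cexp ((κ * s * t : ℝ) * I) * deriv f t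
        - cexp ((κ * s * t : ℝ) * I) * (I * κ * s) * f t))
      (cexp ((κ * s * t : ℝ) * I) * prolateOp κ T f t - cexp ((κ * s * t : ℝ) * I) *
        (((T ^ 2 - s ^ 2) * (I * κ * t) ^ 2 - 2 * s * (I * κ * t)
          + (κ * T) ^ 2 * (T ^ 2 - s ^ 2)) * f t)) t := by
    intro t
    have e := hasDerivAt_expKernel_right κ s t
    have d1 := (hf.differentiable two_ne_zero t).hasDerivAt
    have d2 := (hd1.differentiable one_ne_zero t).hasDerivAt
    have p : HasDerivAt (fun t : ℝ => (T : ℂ) ^ 2 - (t : ℂ) ^ 2) (-(2 * t)) t := by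
      have := ((hasDerivAt_id t).ofReal_comp.pow 2).const_sub ((T : ℂ) ^ 2)
      simpa using this
    convert! p.mul ((e.mul d2).sub ((e.mul_const (I * κ * s)).mul d1)) using 1
    simp only [prolateOp, Pi.mul_apply, Pi.sub_apply]
    ring_nf
    simp only [I_sq]
    ring
  have hftc := integral_eq_sub_of_hasDerivAt (a := -T) (b := T) (fun t _ => hder t)
    (Continuous.intervalIntegrable (by fun_prop) _ _)
  rw [intervalIntegral.integral_sub (Continuous.intervalIntegrable (by fun_prop) _ _)
    (Continuous.intervalIntegrable (by fun_prop) _ _)] at hftc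
  have hz : ∫ t in (-T)..T, cexp ((κ * s * t : ℝ) * I) * prolateOp κ T f t =
      ∫ t in (-T)..T, cexp ((κ * s * t : ℝ) * I) *
        (((T ^ 2 - s ^ 2) * (I * κ * t) ^ 2 - 2 * s * (I * κ * t)
          + (κ * T) ^ 2 * (T ^ 2 - s ^ 2)) * f t) := by
    rw [← sub_eq_zero, hftc]
    push_cast
    ring
  conv_rhs => rw [finFourier, hz]
  unfold prolateOp
  rw [deriv_finFourier κ T h0, deriv_finFourier κ T (by fun_prop)]
  unfold finFourier
  simp_rw [← intervalIntegral.integral_const_mul]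
  rw [← intervalIntegral.integral_sub (Continuous.intervalIntegrable (by fun_prop) _ _)
    (Continuous.intervalIntegrable (by fun_prop) _ _),
    ← intervalIntegral.integral_add (Continuous.intervalIntegrable (by fun_prop) _ _)
    (Continuous.intervalIntegrable (by fun_prop) _ _)]
  congr 1; ext t
  ring

end PFD

end

/-! ### Eigenspaces of `F F*` are one-dimensional. -/

noncomputable section

namespace PFD

open Complex Set Filter Topology intervalIntegral
open scoped ContDiff

/-- `f` is a continuous solution of `F F* f = ν f`, where `F` is the finite Fourier transform and
`F*` its reflection. -/
structure IsFourierEigen (κ T : ℝ) (ν : ℂ) (f : ℝ → ℂ) : Prop where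
  cont : Continuous f
  eigen : ∀ s, finFourier κ T (fun u => finFourier κ T f (-u)) s = ν * f s

namespace IsFourierEigen

variable {κ T : ℝ} {ν : ℂ} {f g : ℝ → ℂ}

lemma continuous_finFourier_neg (κ T : ℝ) (hf : Continuous f) :
    Continuous fun u => finFourier κ T f (-u) :=
  (continuous_finFourier κ T (hf.intervalIntegrable _ _)).comp continuous_neg

lemma eq_finFourier (hν : ν ≠ 0) (hf : IsFourierEigen κ T ν f) :
    f = finFourier κ T (fun u => ν⁻¹ * finFourier κ T f (-u)) := by
  ext s
  rw [finFourier_const_mul, hf.eigen, inv_mul_cancel_left₀ hν]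

lemma contDiff (hν : ν ≠ 0) (hf : IsFourierEigen κ T ν f) : ContDiff ℝ ∞ f := by
  rw [hf.eq_finFourier hν]
  exact contDiff_finFourier κ T (continuous_const.mul (continuous_finFourier_neg κ T hf.cont))

lemma const_mul (hf : IsFourierEigen κ T ν f) (c : ℂ) :
    IsFourierEigen κ T ν fun t => c * f t where
  cont := continuous_const.mul hf.cont
  eigen s := by
    simp_rw [finFourier_const_mul, hf.eigen]
    ring

lemma sub (hf : IsFourierEigen κ T ν f) (hg : IsFourierEigen κ T ν g) :
    IsFourierEigen κ T ν fun t => f t - g t where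
  cont := hf.cont.sub hg.cont
  eigen s := by
    simp_rw [finFourier_sub κ T hf.cont hg.cont]
    rw [finFourier_sub κ T (continuous_finFourier_neg κ T hf.cont)
      (continuous_finFourier_neg κ T hg.cont), hf.eigen, hg.eigen]
    ring

lemma comp_neg (hf : IsFourierEigen κ T ν f) : IsFourierEigen κ T ν fun t => f (-t) where
  cont := hf.cont.comp continuous_neg
  eigen s := by
    simp_rw [finFourier_comp_neg]
    rw [← hf.eigen (-s), ← finFourier_comp_neg]

lemma finFourier (hf : IsFourierEigen κ T ν f) :
    IsFourierEigen κ T ν (PFD.finFourier κ T f) where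
  cont := continuous_finFourier κ T (hf.cont.intervalIntegrable _ _)
  eigen s := by
    simp_rw [← finFourier_comp_neg κ T (PFD.finFourier κ T f)]
    have h : PFD.finFourier κ T (fun t => PFD.finFourier κ T f (-t)) = fun t => ν * f t :=
      funext hf.eigen
    rw [h, finFourier_const_mul]

lemma prolateOp (hν : ν ≠ 0) (hf : IsFourierEigen κ T ν f) :
    IsFourierEigen κ T ν (PFD.prolateOp κ T f) where
  cont := continuous_prolateOp κ T (contDiff_infty.1 (hf.contDiff hν) 2)
  eigen s := by
    have h2 : ContDiff ℝ 2 f := contDiff_infty.1 (hf.contDiff hν) 2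
    simp_rw [← prolateOp_finFourier κ T h2, ← prolateOp_comp_neg]
    have h3 : ContDiff ℝ 2 fun u => PFD.finFourier κ T f (-u) :=
      contDiff_infty.1 ((contDiff_finFourier κ T hf.cont).comp contDiff_neg) 2
    have := prolateOp_finFourier κ T h3 s
    change PFD.finFourier κ T (PFD.prolateOp κ T fun u => PFD.finFourier κ T f (-u)) s = _
    rw [← this, show PFD.finFourier κ T (fun u => PFD.finFourier κ T f (-u)) = fun t => ν * f t
      from funext hf.eigen, prolateOp_const_mul]

/-- The bilinear form `∫ f' g` is antisymmetric on an eigenspace. -/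
lemma integral_deriv_mul (hν : ν ≠ 0) (hf : IsFourierEigen κ T ν f)
    (hg : IsFourierEigen κ T ν g) :
    ∫ t in (-T)..T, deriv f t * g t = -∫ t in (-T)..T, f t * deriv g t := by
  -- Differentiating the eigenvalue equation produces the odd factor `iκu`, and symmetry of `F`
  -- moves the outer transform onto `g`. Exchanging `f` and `g` together with `u ↦ -u` then changes
  -- only the sign.
  have key : ∀ {f g : ℝ → ℂ}, IsFourierEigen κ T ν f → IsFourierEigen κ T ν g →
      ν * ∫ t in (-T)..T, deriv f t * g t =
        ∫ u in (-T)..T, I * κ * u * PFD.finFourier κ T f (-u) * PFD.finFourier κ T g u := by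
    intro f g hf hg
    have hc := continuous_finFourier_neg κ T hf.cont
    have h : ∀ t, ν * deriv f t =
        PFD.finFourier κ T (fun u => I * κ * u * PFD.finFourier κ T f (-u)) t := by
      intro t
      rw [← deriv_finFourier κ T hc, show PFD.finFourier κ T (fun u => PFD.finFourier κ T f (-u))
        = fun t => ν * f t from funext hf.eigen, deriv_const_mul_field]
    rw [← integral_finFourier_mul κ T (by fun_prop) hg.cont, ← intervalIntegral.integral_const_mul]
    congr 1; ext t
    rw [← h]; ring
  refine mul_left_cancel₀ hν ?_
  have e : ∫ t in (-T)..T, f t * deriv g t = ∫ t in (-T)..T, deriv g t * f t := by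
    simp_rw [mul_comm]
  rw [e, mul_neg, key hf hg, key hg hf, ← intervalIntegral.integral_neg]
  rw [← neg_neg T, ← integral_comp_neg, neg_neg]
  congr 1; ext t
  simp only [neg_neg]
  push_cast
  ring

/-- By antisymmetry the integral of `(fg)'` over `[-T, T]` is zero. -/
lemma mul_endpoint_eq (hν : ν ≠ 0) (hf : IsFourierEigen κ T ν f)
    (hg : IsFourierEigen κ T ν g) : f T * g T = f (-T) * g (-T) := by
  have hf1 : ContDiff ℝ 1 f := (hf.contDiff hν).of_le (by exact_mod_cast le_top)
  have hg1 : ContDiff ℝ 1 g := (hg.contDiff hν).of_le (by exact_mod_cast le_top)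
  have h := integral_deriv_mul_eq_sub (a := -T) (b := T)
    (fun t _ => (hf1.differentiable one_ne_zero t).hasDerivAt)
    (fun t _ => (hg1.differentiable one_ne_zero t).hasDerivAt)
    ((hf1.continuous_deriv le_rfl).intervalIntegrable _ _)
    ((hg1.continuous_deriv le_rfl).intervalIntegrable _ _)
  have c1 := hf1.continuous_deriv le_rfl
  have c2 := hg1.continuous_deriv le_rfl
  have c3 := hf.cont
  have c4 := hg.cont
  rw [intervalIntegral.integral_add (Continuous.intervalIntegrable (by fun_prop) _ _)
    (Continuous.intervalIntegrable (by fun_prop) _ _), hf.integral_deriv_mul hν hg,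
    neg_add_cancel] at h
  exact (sub_eq_zero.1 h.symm)

lemma neg_endpoint_eq_zero (hν : ν ≠ 0) (hf : IsFourierEigen κ T ν f) (h0 : f T = 0) :
    f (-T) = 0 := by
  have := hf.mul_endpoint_eq hν hf
  rw [h0, zero_mul] at this
  exact mul_self_eq_zero.1 this.symm

/-- With `f(±T) = 0` integration by parts has no boundary terms, so `F f' = -iκs F f`; reflecting
and applying `F` again differentiates `F F* f = ν f`. -/
lemma deriv (hν : ν ≠ 0) (hf : IsFourierEigen κ T ν f) (h0 : f T = 0) :
    IsFourierEigen κ T ν (deriv f) where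
  cont := ((hf.contDiff hν).of_le (by exact_mod_cast le_top : (1 : WithTop ℕ∞) ≤ ∞)
    ).continuous_deriv le_rfl
  eigen s := by
    have hf1 : ContDiff ℝ 1 f := (hf.contDiff hν).of_le (by exact_mod_cast le_top)
    have h0' := hf.neg_endpoint_eq_zero hν h0
    simp_rw [finFourier_deriv κ T hf1, h0, h0', mul_zero, sub_zero, zero_sub]
    have hc := continuous_finFourier_neg κ T hf.cont
    have : (fun u : ℝ => -(I * κ * (-u : ℝ) * PFD.finFourier κ T f (-u))) =
        fun u : ℝ => I * κ * u * PFD.finFourier κ T f (-u) := by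
      ext u; push_cast; ring
    rw [this, ← deriv_finFourier κ T hc, show PFD.finFourier κ T (fun u =>
      PFD.finFourier κ T f (-u)) = fun t => ν * f t from funext hf.eigen, deriv_const_mul_field]

/-- At `±T` the differential operator reduces to `∓2T f'(±T)`. Pairing its image of `f` with `f'` in
`mul_endpoint_eq` gives `f'(T)² = -f'(-T)²`, while pairing `f'` with itself gives `f'(T)² =
f'(-T)²`. -/
lemma deriv_endpoint_eq_zero (hT : T ≠ 0) (hν : ν ≠ 0) (hf : IsFourierEigen κ T ν f)
    (h0 : f T = 0) : _root_.deriv f T = 0 := by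
  have hd := hf.deriv hν h0
  have h1 := hd.mul_endpoint_eq hν hd
  have h2 := (hf.prolateOp hν).mul_endpoint_eq hν hd
  have e1 : PFD.prolateOp κ T f T = -2 * T * _root_.deriv f T := by
    simp [PFD.prolateOp]
  have e2 : PFD.prolateOp κ T f (-T) = 2 * T * _root_.deriv f (-T) := by
    simp [PFD.prolateOp]
  have hT' : (T : ℂ) ≠ 0 := by exact_mod_cast hT
  rw [e1, e2, mul_assoc, mul_assoc _ _ (_root_.deriv f (-T)), ← h1] at h2
  have h3 : (T : ℂ) * (_root_.deriv f T * _root_.deriv f T) = 0 := by linear_combination -h2 / 4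
  exact mul_self_eq_zero.1 ((mul_eq_zero.1 h3).resolve_left hT')

lemma iteratedDeriv (hT : T ≠ 0) (hν : ν ≠ 0) (hf : IsFourierEigen κ T ν f) (h0 : f T = 0)
    (n : ℕ) : IsFourierEigen κ T ν (iteratedDeriv n f) ∧ _root_.iteratedDeriv n f T = 0 := by
  induction n with
  | zero => simpa using ⟨hf, h0⟩
  | succ n ih =>
    rw [iteratedDeriv_succ]
    exact ⟨ih.1.deriv hν ih.2, ih.1.deriv_endpoint_eq_zero hT hν ih.2⟩

/-- An eigenfunction is itself a finite transform, hence band-limited: each derivative costs a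
factor of at most `|κ| T`. This makes the Taylor remainders vanish in the limit. -/
lemma exists_norm_iteratedDeriv_le (hT : 0 < T) (hν : ν ≠ 0) (hf : IsFourierEigen κ T ν f) :
    ∃ C, ∀ n s, ‖_root_.iteratedDeriv n f s‖ ≤ C * (|κ| * T) ^ n := by
  have hc : Continuous fun u => ν⁻¹ * PFD.finFourier κ T f (-u) :=
    continuous_const.mul (continuous_finFourier_neg κ T hf.cont)
  obtain ⟨C, hC⟩ := (isCompact_Icc (a := -T) (b := T)).exists_bound_of_continuousOn hc.continuousOn
  refine ⟨C * (2 * T), fun n s => ?_⟩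
  rw [hf.eq_finFourier hν, iteratedDeriv_finFourier κ T hc]
  refine (norm_finFourier_le κ hT.le (C := (|κ| * T) ^ n * C) (fun t ht => ?_) s).trans
    (le_of_eq (by ring))
  rw [norm_mul, norm_pow, norm_mul, norm_mul, norm_I, one_mul, norm_real, norm_real,
    Real.norm_eq_abs, Real.norm_eq_abs]
  gcongr
  · exact abs_le.2 ht
  · exact hC t ht

/-- An eigenfunction that vanishes at the endpoint vanishes identically. -/
lemma eq_zero_of_endpoint (hT : 0 < T) (hν : ν ≠ 0) (hf : IsFourierEigen κ T ν f)
    (h0 : f T = 0) (s : ℝ) : f s = 0 := by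
  have hTT : -T < T := by linarith
  obtain ⟨C, hC⟩ := hf.exists_norm_iteratedDeriv_le hT hν
  have hsm := hf.contDiff hν
  have hit : ∀ n, ∀ x ∈ Icc (-T) T,
      iteratedDerivWithin n f (Icc (-T) T) x = _root_.iteratedDeriv n f x := fun n x hx =>
    iteratedDerivWithin_eq_iteratedDeriv (uniqueDiffOn_Icc hTT)
      ((hsm.of_le (by exact_mod_cast le_top)).contDiffAt) hx
  have hin : ∀ x ∈ Icc (-T) T, f x = 0 := by
    intro x hx
    -- All derivatives vanish at `-T`, so only the Taylor remainder is left; it is of order `Rⁿ /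
    -- n!`.
    have hb : ∀ n : ℕ, ‖f x‖ ≤ C * (|κ| * T) * ((|κ| * T * (x + T)) ^ n / n.factorial) * (x + T) := by
      intro n
      have := taylor_mean_remainder_bound (n := n) hTT.le
        ((hsm.of_le (by exact_mod_cast le_top)).contDiffOn) hx
        (fun y hy => by rw [hit _ y hy]; exact hC (n + 1) y)
      have hz : taylorWithinEval f n (Icc (-T) T) (-T) x = 0 := by
        rw [taylor_within_apply]
        refine Finset.sum_eq_zero fun k _ => ?_
        obtain ⟨hk, hk0⟩ := hf.iteratedDeriv hT.ne' hν h0 k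
        rw [hit k _ ⟨le_rfl, hTT.le⟩, hk.neg_endpoint_eq_zero hν hk0, smul_zero]
      rw [hz, sub_zero] at this
      refine this.trans (le_of_eq ?_)
      rw [sub_neg_eq_add, mul_pow _ (x + T)]
      ring
    have hlim : Tendsto (fun n : ℕ => C * (|κ| * T) * ((|κ| * T * (x + T)) ^ n / n.factorial)
        * (x + T)) atTop (𝓝 (C * (|κ| * T) * 0 * (x + T))) :=
      ((FloorSemiring.tendsto_pow_div_factorial_atTop _).const_mul _).mul_const _
    have := ge_of_tendsto' hlim hb
    simp only [mul_zero, zero_mul] at this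
    exact norm_le_zero_iff.1 this
  -- The transform sees `f` only on `[-T, T]`, so the eigenvalue equation carries the vanishing to
  -- the whole line.
  have h1 : ∀ u, PFD.finFourier κ T f u = 0 := by
    intro u
    unfold PFD.finFourier
    rw [intervalIntegral.integral_congr (g := fun _ => 0), intervalIntegral.integral_zero]
    intro t ht
    rw [uIcc_of_le hTT.le] at ht
    simp [hin t ht]
  have h2 := hf.eigen s
  simp only [h1] at h2
  have h3 : PFD.finFourier κ T (fun _ => (0 : ℂ)) s = 0 := by simp [PFD.finFourier]
  rw [h3] at h2
  exact (mul_eq_zero.1 h2.symm).resolve_left hν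

/-- Eigenspaces of the finite Fourier transform are one-dimensional. -/
lemma exists_eq_const_mul (hT : 0 < T) (hν : ν ≠ 0) (hf : IsFourierEigen κ T ν f)
    (hg : IsFourierEigen κ T ν g) (hg0 : g T ≠ 0) : ∃ c : ℂ, ∀ t, f t = c * g t := by
  refine ⟨f T / g T, fun t => ?_⟩
  have := (hf.sub (hg.const_mul (f T / g T))).eq_zero_of_endpoint hT hν
    (by field_simp; ring) t
  exact sub_eq_zero.1 this

end IsFourierEigen

end PFD

end

/-! ### Plancherel's theorem for the finite Fourier transform. -/

noncomputable section

namespace PFD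

open Complex Set Filter Topology
open scoped ContDiff FourierTransform SchwartzMap

/-- On `L¹ ∩ L²` the `L²` Fourier transform is given by the Fourier integral. -/
lemma fourier_toLp_ae_eq {h : ℝ → ℂ} (h1 : Integrable h) (h2 : MemLp h 2) :
    (𝓕 (h2.toLp h) : Lp ℂ 2 (volume : Measure ℝ)) =ᵐ[volume] 𝓕 h := by
  have hcont : Continuous (𝓕 h) :=
    VectorFourier.fourierIntegral_continuous Real.continuous_fourierChar
      (by exact continuous_inner) h1
  refine ae_eq_of_integral_contDiff_smul_eq ((Lp.memLp _).locallyIntegrable one_le_two)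
    hcont.locallyIntegrable fun g g_diff g_supp => ?_
  have hg₁ : HasCompactSupport (fun x => (g x : ℂ)) := g_supp.comp_left ofReal_zero
  have hg₂ : ContDiff ℝ ∞ (fun x => (g x : ℂ)) := ofRealCLM.contDiff.comp g_diff
  let G : 𝓢(ℝ, ℂ) := hg₁.toSchwartzMap hg₂
  -- The `L²` transform agrees with the distributional one, so it can be moved onto the test
  -- function.
  have key : Lp.toTemperedDistribution (𝓕 (h2.toLp h) : Lp ℂ 2 (volume : Measure ℝ)) G =
      Lp.toTemperedDistribution (h2.toLp h) (𝓕 G) := by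
    rw [← Lp.fourier_toTemperedDistribution_eq]
    rfl
  rw [Lp.toTemperedDistribution_apply, Lp.toTemperedDistribution_apply] at key
  have e1 : ∫ x, g x • (𝓕 (h2.toLp h) : Lp ℂ 2 (volume : Measure ℝ)) x =
      ∫ x, G x • (𝓕 (h2.toLp h) : Lp ℂ 2 (volume : Measure ℝ)) x := by
    congr 1
  have e2 : ∫ x, g x • 𝓕 h x = ∫ x, G x • 𝓕 h x := by
    congr 1
  have e3 : ∫ x, (𝓕 G) x • (h2.toLp h) x = ∫ x, (𝓕 (G : ℝ → ℂ)) x • h x := by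
    refine integral_congr_ae ?_
    filter_upwards [h2.coeFn_toLp] with x hx
    rw [hx, SchwartzMap.fourier_coe]
  rw [e1, e2, key, e3]
  have := VectorFourier.integral_fourierIntegral_smul_eq_flip (L := innerₗ ℝ)
    Real.continuous_fourierChar (by exact continuous_inner) (G.integrable (μ := volume)) h1
  rw [flip_innerₗ] at this
  exact this

/-- Plancherel's theorem for the Fourier integral on `L¹ ∩ L²`. -/
lemma plancherel {h : ℝ → ℂ} (h1 : Integrable h) (h2 : MemLp h 2) :
    MemLp (𝓕 h) 2 ∧ ∫ x, ‖𝓕 h x‖ ^ 2 = ∫ x, ‖h x‖ ^ 2 := by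
  have hae := fourier_toLp_ae_eq h1 h2
  have hm : MemLp (𝓕 h) 2 := (memLp_congr_ae hae).1 (Lp.memLp _)
  refine ⟨hm, ?_⟩
  have hn : ‖hm.toLp (𝓕 h)‖ = ‖h2.toLp h‖ := by
    rw [← Lp.norm_fourier_eq (h2.toLp h)]
    congr 1
    rw [← Lp.toLp_coeFn (𝓕 (h2.toLp h)) (Lp.memLp _)]
    exact (MemLp.toLp_eq_toLp_iff _ _).2 hae.symm
  have sq : ∀ {u : ℝ → ℂ} (hu : MemLp u 2), ‖hu.toLp u‖ ^ 2 = ∫ x, ‖u x‖ ^ 2 := by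
    intro u hu
    have := inner_self_eq_norm_sq (𝕜 := ℂ) (hu.toLp u)
    rw [← this, L2.inner_def]
    rw [← integral_re (L2.integrable_inner _ _)]
    refine integral_congr_ae ?_
    filter_upwards [hu.coeFn_toLp] with x hx
    rw [hx, inner_self_eq_norm_sq]
  rw [← sq hm, ← sq h2, hn]

lemma finFourier_eq_fourier (κ : ℝ) {T : ℝ} (hT : 0 ≤ T) (f : ℝ → ℂ) (s : ℝ) :
    finFourier κ T f s = 𝓕 ((Ioc (-T) T).indicator f) (-(κ / (2 * Real.pi)) * s) := by
  rw [Real.fourier_real_eq_integral_exp_smul, finFourier,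
    intervalIntegral.integral_of_le (by linarith), ← integral_indicator measurableSet_Ioc]
  congr 1; ext t
  by_cases ht : t ∈ Ioc (-T) T
  · simp only [indicator_of_mem ht, smul_eq_mul]
    congr 4
    field_simp
  · simp [indicator_of_notMem ht]

/-- Plancherel's theorem for the finite Fourier transform. -/
lemma finFourier_plancherel {κ T : ℝ} (hκ : 0 < κ) (hT : 0 ≤ T) {f : ℝ → ℂ} (hf : Continuous f) :
    MemLp (finFourier κ T f) 2 ∧
      ∫ s, ‖finFourier κ T f s‖ ^ 2 = 2 * Real.pi / κ * ∫ t in (-T)..T, ‖f t‖ ^ 2 := by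
  have hp := Real.pi_pos
  have hc : -(κ / (2 * Real.pi)) ≠ 0 := by
    have : 0 < κ / (2 * Real.pi) := by positivity
    linarith
  have h1 : Integrable ((Ioc (-T) T).indicator f) :=
    (integrable_indicator_iff measurableSet_Ioc).2
      (hf.integrableOn_Icc.mono_set Ioc_subset_Icc_self)
  have h2 : MemLp ((Ioc (-T) T).indicator f) 2 := by
    rw [memLp_indicator_iff_restrict measurableSet_Ioc]
    refine (memLp_two_iff_integrable_sq_norm hf.aestronglyMeasurable).2 ?_
    exact (Continuous.integrableOn_Icc (by fun_prop)).mono_set Ioc_subset_Icc_self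
  obtain ⟨hm, hn⟩ := plancherel h1 h2
  have e : finFourier κ T f =
      fun s => 𝓕 ((Ioc (-T) T).indicator f) (-(κ / (2 * Real.pi)) * s) :=
    funext (finFourier_eq_fourier κ hT f)
  constructor
  · rw [e]
    refine (memLp_two_iff_integrable_sq_norm ?_).2 ?_
    · exact (e ▸ (continuous_finFourier κ T (hf.intervalIntegrable _ _)).aestronglyMeasurable)
    · exact ((memLp_two_iff_integrable_sq_norm hm.1).1 hm).comp_mul_left' hc
  · rw [e]
    simp only
    rw [Measure.integral_comp_mul_left
      (fun y => ‖𝓕 ((Ioc (-T) T).indicator f) y‖ ^ 2) (-(κ / (2 * Real.pi))), hn, smul_eq_mul,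
      intervalIntegral.integral_of_le (by linarith), ← integral_indicator measurableSet_Ioc]
    congr 1
    · rw [abs_inv, abs_neg, abs_of_pos (by positivity), inv_div]
    · congr 1; ext t
      by_cases ht : t ∈ Ioc (-T) T
      · simp [indicator_of_mem ht]
      · simp [indicator_of_notMem ht]

end PFD

end

/-! ### Prolates as eigenfunctions of `F F*`. -/

noncomputable section

namespace PFD

open Complex Set Filter Topology
open scoped ContDiff

/-- A normalized prolate function `f` of bandwidth `W` concentrated on `[-T, T]`, with
eigenvalue `g`. -/
structure IsProlate (W T g : ℝ) (f : ℝ → ℝ) : Prop where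
  memLp : MemLp f 2 volume
  eigen : ∀ s, ∫ t in (-T)..T, rho W (s - t) * f t = g * f s
  pos : 0 < g
  norm_one : ∫ t, f t ^ 2 = 1

lemma IsProlateSequence.isProlate {W T : ℝ} {γ : ℕ → ℝ} {ξ : ℕ → ℝ → ℝ}
    (h : IsProlateSequence W T γ ξ) (n : ℕ) : IsProlate W T (γ n) (ξ n) where
  memLp := h.memLp n
  eigen := h.eigen n
  pos := h.pos n
  norm_one := by simpa [sq] using h.orthonormal n n

lemma finFourier_one (κ T x : ℝ) (hκ : κ ≠ 0) :
    finFourier κ T (fun _ => 1) x = ((2 * Real.pi / κ * rho (κ * T) x : ℝ) : ℂ) := by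
  unfold finFourier rho
  have hp := Real.pi_ne_zero
  by_cases hx : κ * T * x = 0
  · rcases eq_or_ne x 0 with rfl | hx0
    · simp only [mul_zero, zero_mul, ofReal_zero, exp_zero, mul_one, Real.sinc_zero,
        intervalIntegral.integral_const, sub_neg_eq_add, real_smul]
      congr 1
      field_simp
      ring
    · have hT : T = 0 := by
        rcases mul_eq_zero.1 hx with h | h
        · exact (mul_eq_zero.1 h).resolve_left hκ
        · exact absurd h hx0
      simp [hT]
  · have hx0 : x ≠ 0 := right_ne_zero_of_mul hx
    have hT : T ≠ 0 := right_ne_zero_of_mul (left_ne_zero_of_mul hx)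
    have hc : ((κ * x : ℝ) : ℂ) * I ≠ 0 :=
      mul_ne_zero (by exact_mod_cast mul_ne_zero hκ hx0) I_ne_zero
    have e : ∫ t in (-T)..T, cexp ((κ * x * t : ℝ) * I) * 1 =
        ∫ t in (-T)..T, cexp (((κ * x : ℝ) * I) * t) := by
      congr 1; ext t
      rw [mul_one]; congr 1; push_cast; ring
    rw [e, integral_exp_mul_complex hc, Real.sinc_of_ne_zero hx]
    have hs : cexp ((κ * x : ℝ) * I * (T : ℝ)) - cexp ((κ * x : ℝ) * I * (-T : ℝ)) =
        2 * I * (Real.sin (κ * T * x) : ℝ) := by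
      rw [ofReal_sin, Complex.sin]
      have e1 : (κ * x : ℝ) * I * (T : ℝ) = ((κ * T * x : ℝ) : ℂ) * I := by push_cast; ring
      have e2 : (κ * x : ℝ) * I * (-T : ℝ) = -((κ * T * x : ℝ) : ℂ) * I := by push_cast; ring
      rw [e1, e2]
      ring_nf
      simp only [I_sq]
      ring
    rw [hs]
    push_cast
    have hκ' : (κ : ℂ) ≠ 0 := by exact_mod_cast hκ
    have hx' : (x : ℂ) ≠ 0 := by exact_mod_cast hx0
    have hT' : (T : ℂ) ≠ 0 := by exact_mod_cast hT
    have hp' : (Real.pi : ℂ) ≠ 0 := by exact_mod_cast hp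
    field_simp

/-- The composition has kernel `∫ e^{iκ(s-t)u} du` over `[-T, T]`, which is the sampling kernel of
bandwidth `κT` up to the factor `2π/κ`. -/
lemma finFourier_finFourier_neg {κ : ℝ} (hκ : κ ≠ 0) (T : ℝ) {f : ℝ → ℂ}
    (hf : IntervalIntegrable f volume (-T) T) (s : ℝ) :
    finFourier κ T (fun u => finFourier κ T f (-u)) s =
      (2 * Real.pi / κ : ℝ) * ∫ t in (-T)..T, (rho (κ * T) (s - t) : ℂ) * f t := by
  have e : ∀ t : ℝ, ((2 * Real.pi / κ : ℝ) : ℂ) * ((rho (κ * T) (s - t) : ℂ) * f t) =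
      ∫ u in (-T)..T, cexp ((κ * s * u : ℝ) * I) * (cexp ((κ * -u * t : ℝ) * I) * f t) := by
    intro t
    rw [← mul_assoc, ← ofReal_mul, ← finFourier_one κ T _ hκ, finFourier,
      ← intervalIntegral.integral_mul_const]
    congr 1; ext u
    rw [mul_one, ← mul_assoc, ← Complex.exp_add]
    congr 2
    push_cast; ring
  rw [← intervalIntegral.integral_const_mul]
  simp_rw [e]
  unfold finFourier
  simp_rw [← intervalIntegral.integral_const_mul]
  refine intervalIntegral_intervalIntegral_swap ?_
  -- As `f` is merely integrable, joint integrability comes from `1 · f` multiplied by a unimodular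
  -- kernel.
  have h1 : Integrable (fun p : ℝ × ℝ => (1 : ℂ) * f p.2)
      ((volume.restrict (uIoc (-T) T)).prod (volume.restrict (uIoc (-T) T))) :=
    ((_root_.intervalIntegrable_const (μ := volume) (a := -T) (b := T)
      (c := (1 : ℂ))).def').mul_prod hf.def'
  rw [IntegrableOn, Measure.volume_eq_prod, ← Measure.prod_restrict]
  refine (h1.bdd_mul (c := 1) (f := fun p : ℝ × ℝ =>
    cexp ((κ * s * p.1 : ℝ) * I) * cexp ((κ * -p.1 * p.2 : ℝ) * I))
    (Continuous.aestronglyMeasurable (by fun_prop)) ?_).congr ?_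
  · refine Eventually.of_forall fun p => ?_
    rw [norm_mul, norm_exp_ofReal_mul_I, norm_exp_ofReal_mul_I, one_mul]
  · refine Eventually.of_forall fun p => ?_
    simp only [Function.uncurry]
    ring

namespace IsProlate

variable {W T g : ℝ} {f : ℝ → ℝ}

lemma intervalIntegrable (h : IsProlate W T g f) (a b : ℝ) : IntervalIntegrable f volume a b :=
  ((h.memLp.locallyIntegrable one_le_two).integrableOn_isCompact
    isCompact_uIcc).intervalIntegrable

lemma isFourierEigen (hW : 0 < W) (hT : 0 < T) (h : IsProlate W T g f) :
    IsFourierEigen (W / T) T ((2 * Real.pi * g / (W / T) : ℝ) : ℂ) (fun t => (f t : ℂ)) := by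
  have hκ : 0 < W / T := by positivity
  have hi : IntervalIntegrable (fun t => (f t : ℂ)) volume (-T) T :=
    ⟨(h.intervalIntegrable _ _).1.ofReal, (h.intervalIntegrable _ _).2.ofReal⟩
  have heig : ∀ s, finFourier (W / T) T (fun u => finFourier (W / T) T (fun t => (f t : ℂ)) (-u)) s
      = ((2 * Real.pi * g / (W / T) : ℝ) : ℂ) * f s := by
    intro s
    rw [finFourier_finFourier_neg hκ.ne' T hi, div_mul_cancel₀ W hT.ne']
    have : ∫ t in (-T)..T, (rho W (s - t) : ℂ) * (f t : ℂ) = ((g * f s : ℝ) : ℂ) := by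
      rw [← h.eigen s, ← intervalIntegral.integral_ofReal]
      simp
    rw [this]
    push_cast
    ring
  refine ⟨?_, heig⟩
  -- Continuity is not assumed: the eigenvalue equation holds at every point and its left side is a
  -- transform, hence continuous.
  have hc : Continuous fun s => ((2 * Real.pi * g / (W / T) : ℝ) : ℂ) * f s := by
    rw [← funext heig]
    exact continuous_finFourier _ _ (Continuous.intervalIntegrable
      ((continuous_finFourier _ _ hi).comp continuous_neg) _ _)
  have hν : ((2 * Real.pi * g / (W / T) : ℝ) : ℂ) ≠ 0 := by
    have := h.pos
    have := Real.pi_pos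
    exact_mod_cast (by positivity : 2 * Real.pi * g / (W / T) ≠ 0)
  have := hc.const_mul (((2 * Real.pi * g / (W / T) : ℝ) : ℂ)⁻¹)
  simpa only [inv_mul_cancel_left₀ hν] using this

end IsProlate

end PFD

end

/-! ### Energy identities and decay of a prolate outside its interval. -/

noncomputable section

namespace PFD

open Complex Set Filter Topology
open scoped ContDiff

lemma deriv_ofReal_comp {f : ℝ → ℝ} (hf : Differentiable ℝ f) :
    deriv (fun t => (f t : ℂ)) = fun t => ((deriv f t : ℝ) : ℂ) :=
  funext fun t => (hf t).hasDerivAt.ofReal_comp.deriv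

lemma conj_finFourier_ofReal (κ : ℝ) {T : ℝ} (hT : 0 ≤ T) (f : ℝ → ℝ) (s : ℝ) :
    (starRingEnd ℂ) (finFourier κ T (fun t => (f t : ℂ)) s) =
      finFourier κ T (fun t => (f t : ℂ)) (-s) := by
  unfold finFourier
  rw [intervalIntegral.integral_of_le (by linarith), intervalIntegral.integral_of_le
    (by linarith), ← integral_conj]
  congr 1; ext t
  rw [map_mul, conj_ofReal, ← exp_conj, map_mul, conj_ofReal, conj_I]
  congr 2
  push_cast; ring

lemma setIntegral_Iic_neg_eq_Ioi {F : ℝ → ℝ} (heven : ∀ t, F (-t) = F t) (T : ℝ) :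
    ∫ t in Iic (-T), F t = ∫ t in Ioi T, F t := by
  rw [← integral_comp_neg_Ioi]
  simp [heven]

lemma integral_eq_interval_add_two_mul_Ioi {F : ℝ → ℝ} (hF : Integrable F)
    (heven : ∀ t, F (-t) = F t) (T : ℝ) :
    ∫ t, F t = (∫ t in (-T)..T, F t) + 2 * ∫ t in Ioi T, F t := by
  have h1 := intervalIntegral.integral_Iic_sub_Iic (a := -T) (b := T)
    hF.integrableOn hF.integrableOn
  have h2 := intervalIntegral.integral_Iic_add_Ioi (b := T) hF.integrableOn hF.integrableOn
  have h3 := setIntegral_Iic_neg_eq_Ioi heven T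
  linarith

/-- Agmon's inequality on a half-line. -/
lemma sq_le_of_hasDerivAt_of_memLp {f f' : ℝ → ℝ} {T : ℝ} (hd : ∀ t, HasDerivAt f (f' t) t)
    (hf : MemLp f 2) (hf' : MemLp f' 2) {s : ℝ} (hs : T ≤ s) :
    f s ^ 2 ≤ 2 * (√(∫ t in Ioi T, f t ^ 2) * √(∫ t in Ioi T, f' t ^ 2)) := by
  have hd2 : ∀ t, HasDerivAt (fun t => f t ^ 2) (2 * (f t * f' t)) t := by
    intro t
    convert! (hd t).pow 2 using 1
    simp; ring
  have hi : Integrable fun t => 2 * (f t * f' t) := (hf.integrable_mul hf').const_mul 2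
  have hi2 : Integrable fun t => f t ^ 2 := hf.integrable_sq
  have hlim := tendsto_zero_of_hasDerivAt_of_integrableOn_Ioi (a := s) (fun x _ => hd2 x)
    hi.integrableOn hi2.integrableOn
  have heq := integral_Ioi_of_hasDerivAt_of_tendsto' (a := s) (fun x _ => hd2 x)
    hi.integrableOn hlim
  have hcs := integral_mul_norm_le_Lp_mul_Lq (μ := volume.restrict (Ioi T)) (f := f) (g := f')
    Real.HolderConjugate.two_two (by simpa using hf.restrict _) (by simpa using hf'.restrict _)
  simp only [Real.norm_eq_abs, Real.rpow_two, sq_abs, ← Real.sqrt_eq_rpow] at hcs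
  calc f s ^ 2 = -∫ t in Ioi s, 2 * (f t * f' t) := by rw [heq]; ring
    _ ≤ ∫ t in Ioi s, 2 * (|f t| * |f' t|) := by
        rw [← integral_neg]
        refine integral_mono hi.integrableOn.neg ?_ fun t => ?_
        · simp_rw [← abs_mul]
          exact ((hf.integrable_mul hf').abs.const_mul 2).integrableOn
        · simp only
          rw [← abs_mul]
          linarith [neg_abs_le (f t * f' t)]
    _ ≤ ∫ t in Ioi T, 2 * (|f t| * |f' t|) := by
        refine setIntegral_mono_set ?_ (Eventually.of_forall fun t => by positivity)
          (Ioi_subset_Ioi hs).eventuallyLE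
        simp_rw [← abs_mul]
        exact ((hf.integrable_mul hf').abs.const_mul 2).integrableOn
    _ ≤ _ := by
        rw [integral_const_mul]
        gcongr

namespace IsProlate

variable {W T g : ℝ} {f : ℝ → ℝ}

lemma eigenvalue_ne_zero (hW : 0 < W) (hT : 0 < T) (h : IsProlate W T g f) :
    ((2 * Real.pi * g / (W / T) : ℝ) : ℂ) ≠ 0 := by
  have := h.pos
  have := Real.pi_pos
  exact_mod_cast (by positivity : 2 * Real.pi * g / (W / T) ≠ 0)

lemma contDiff (hW : 0 < W) (hT : 0 < T) (h : IsProlate W T g f) : ContDiff ℝ ∞ f := by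
  have := (h.isFourierEigen hW hT).contDiff (h.eigenvalue_ne_zero hW hT)
  exact reCLM.contDiff.comp this

lemma differentiable (hW : 0 < W) (hT : 0 < T) (h : IsProlate W T g f) : Differentiable ℝ f :=
  (h.contDiff hW hT).differentiable (by simp)

lemma endpoint_ne_zero (hW : 0 < W) (hT : 0 < T) (h : IsProlate W T g f) : (f T : ℂ) ≠ 0 := by
  intro h0
  have hz := (h.isFourierEigen hW hT).eq_zero_of_endpoint hT (h.eigenvalue_ne_zero hW hT) h0
  have : ∀ t, f t = 0 := fun t => by exact_mod_cast hz t
  have h1 := h.norm_one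
  simp [this] at h1

/-- A prolate is an eigenfunction of the finite Fourier transform. -/
lemma exists_finFourier_eq (hW : 0 < W) (hT : 0 < T) (h : IsProlate W T g f) :
    ∃ μ : ℂ, (∀ s, finFourier (W / T) T (fun t => (f t : ℂ)) s = μ * f s) ∧
      ‖μ‖ ^ 2 = 2 * Real.pi * g / (W / T) := by
  have he := h.isFourierEigen hW hT
  have hν := h.eigenvalue_ne_zero hW hT
  have h0 := h.endpoint_ne_zero hW hT
  obtain ⟨μ, hμ⟩ := he.finFourier.exists_eq_const_mul hT hν he h0
  refine ⟨μ, hμ, ?_⟩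
  -- For real `f`, reflecting the transform is conjugating it, so the eigenvalue of `F F*` is `μ
  -- μ̄`.
  have hconj : ∀ u, finFourier (W / T) T (fun t => (f t : ℂ)) (-u) =
      (starRingEnd ℂ) μ * f u := by
    intro u
    rw [← conj_finFourier_ofReal _ hT.le, hμ, map_mul, conj_ofReal]
  have := he.eigen T
  simp_rw [hconj] at this
  rw [finFourier_const_mul, hμ, ← mul_assoc] at this
  have h2 := mul_right_cancel₀ h0 this
  rw [mul_comm, mul_conj, normSq_eq_norm_sq] at h2
  exact_mod_cast h2

/-- Reflection preserves the one-dimensional eigenspace, and `f(T) ≠ 0` forces the factor to square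
to one. -/
lemma exists_parity (hW : 0 < W) (hT : 0 < T) (h : IsProlate W T g f) :
    ∃ ε : ℝ, ε ^ 2 = 1 ∧ ∀ t, f (-t) = ε * f t := by
  have he := h.isFourierEigen hW hT
  have h0 := h.endpoint_ne_zero hW hT
  obtain ⟨c, hc⟩ := he.comp_neg.exists_eq_const_mul hT (h.eigenvalue_ne_zero hW hT) he h0
  have hre : ∀ t, f (-t) = c.re * f t := by
    intro t
    have := congrArg re (hc t)
    simpa using this
  refine ⟨c.re, ?_, hre⟩
  have h1 := hre (-T)
  rw [neg_neg, hre T] at h1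
  have h0' : f T ≠ 0 := by exact_mod_cast h0
  refine mul_right_cancel₀ h0' ?_
  rw [one_mul]
  nth_rewrite 2 [h1]
  ring

lemma sq_neg (hW : 0 < W) (hT : 0 < T) (h : IsProlate W T g f) (t : ℝ) :
    f (-t) ^ 2 = f t ^ 2 := by
  obtain ⟨ε, hε, hp⟩ := h.exists_parity hW hT
  rw [hp, mul_pow, hε, one_mul]

lemma deriv_sq_neg (hW : 0 < W) (hT : 0 < T) (h : IsProlate W T g f) (t : ℝ) :
    deriv f (-t) ^ 2 = deriv f t ^ 2 := by
  obtain ⟨ε, hε, hp⟩ := h.exists_parity hW hT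
  have h1 : deriv (fun t => f (-t)) t = ε * deriv f t := by
    rw [show (fun t => f (-t)) = fun t => ε * f t from funext hp, deriv_const_mul_field]
  rw [deriv_comp_neg] at h1
  rw [← neg_sq, h1, mul_pow, hε, one_mul]

/-- The prolate differential equation. -/
lemma exists_spheroidalOp_eq (hW : 0 < W) (hT : 0 < T) (h : IsProlate W T g f) :
    ∃ lam : ℝ, ∀ t, spheroidalOp W T f t = -lam * f t := by
  have he := h.isFourierEigen hW hT
  have hν := h.eigenvalue_ne_zero hW hT
  obtain ⟨c, hc⟩ := (he.prolateOp hν).exists_eq_const_mul hT hν he (h.endpoint_ne_zero hW hT)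
  refine ⟨-c.re, fun t => ?_⟩
  have hd := h.differentiable hW hT
  have hd' : Differentiable ℝ (deriv f) :=
    ((contDiff_succ_iff_deriv (n := 1)).1
      (contDiff_infty.1 (h.contDiff hW hT) 2)).2.2.differentiable one_ne_zero
  have e : prolateOp (W / T) T (fun t => (f t : ℂ)) t = (spheroidalOp W T f t : ℂ) := by
    unfold prolateOp spheroidalOp
    rw [deriv_ofReal_comp hd, deriv_ofReal_comp hd']
    have : ((W / T : ℝ) : ℂ) * T = W := by
      rw [← ofReal_mul, div_mul_cancel₀ W hT.ne']
    rw [this]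
    push_cast
    ring
  have := congrArg re (hc t)
  rw [e] at this
  simpa using this

lemma spheroidalOp_eq (hW : 0 < W) (hT : 0 < T) (h : IsProlate W T g f) (t : ℝ) :
    spheroidalOp W T f t = -spheroidalEigenvalue W T f * f t :=
  Classical.epsilon_spec (h.exists_spheroidalOp_eq hW hT) t

lemma norm_finFourier_sq (hW : 0 < W) (hT : 0 < T) (h : IsProlate W T g f) (s : ℝ) :
    ‖finFourier (W / T) T (fun t => (f t : ℂ)) s‖ ^ 2 = 2 * Real.pi * g / (W / T) * f s ^ 2 := by
  obtain ⟨μ, hμ, hn⟩ := h.exists_finFourier_eq hW hT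
  rw [hμ, norm_mul, mul_pow, hn, norm_real, Real.norm_eq_abs, sq_abs]

/-- The eigenvalue is the energy on the interval of concentration. -/
lemma integral_sq (hW : 0 < W) (hT : 0 < T) (h : IsProlate W T g f) :
    ∫ t in (-T)..T, f t ^ 2 = g := by
  have hκ : 0 < W / T := by positivity
  -- Here `|F f|² = (2πg/κ) f²`, so Plancherel compares `g ‖f‖²` with the energy of `f` on `[-T,
  -- T]`.
  have hp := (finFourier_plancherel hκ hT.le (h.isFourierEigen hW hT).cont).2
  simp_rw [h.norm_finFourier_sq hW hT, norm_real, Real.norm_eq_abs, sq_abs] at hp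
  rw [integral_const_mul, h.norm_one] at hp
  have := Real.pi_pos
  have hc : 2 * Real.pi / (W / T) ≠ 0 := by positivity
  refine mul_left_cancel₀ hc ?_
  rw [← hp]
  ring

/-- Differentiating `F f = μ f` gives `F(iκt f) = μ f'`, to which Plancherel applies. -/
lemma memLp_deriv_and_integral (hW : 0 < W) (hT : 0 < T) (h : IsProlate W T g f) :
    MemLp (deriv f) 2 ∧
      g * ∫ t, deriv f t ^ 2 = (W / T) ^ 2 * ∫ t in (-T)..T, t ^ 2 * f t ^ 2 := by
  have hκ : 0 < W / T := by positivity
  have hc := (h.isFourierEigen hW hT).cont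
  obtain ⟨μ, hμ, hn⟩ := h.exists_finFourier_eq hW hT
  have hπ := Real.pi_pos
  have hg := h.pos
  have hμ0 : ‖μ‖ ^ 2 ≠ 0 := by rw [hn]; positivity
  have hd : ∀ s, finFourier (W / T) T (fun t => I * (W / T : ℝ) * t * f t) s
      = μ * deriv f s := by
    intro s
    rw [← deriv_finFourier _ _ hc, funext hμ, deriv_const_mul_field,
      deriv_ofReal_comp (h.differentiable hW hT)]
  obtain ⟨hm, hp⟩ := finFourier_plancherel (f := fun t => I * (W / T : ℝ) * t * f t) hκ hT.le
    (by fun_prop)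
  have hcd : Continuous (deriv f) :=
    (contDiff_infty.1 (h.contDiff hW hT) 1).continuous_deriv le_rfl
  constructor
  · rw [memLp_two_iff_integrable_sq_norm hm.1] at hm
    refine (memLp_two_iff_integrable_sq hcd.aestronglyMeasurable).2 ?_
    refine (hm.const_mul (‖μ‖ ^ 2)⁻¹).congr (Eventually.of_forall fun s => ?_)
    simp only [hd, norm_mul, mul_pow, norm_real, Real.norm_eq_abs, sq_abs]
    rw [inv_mul_cancel_left₀ hμ0]
  · simp only [hd, norm_mul, mul_pow, norm_real, Real.norm_eq_abs, sq_abs, norm_I,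
      one_mul] at hp
    rw [integral_const_mul, hn] at hp
    simp_rw [mul_assoc ((W / T) ^ 2)] at hp
    rw [intervalIntegral.integral_const_mul] at hp
    have hcc : 2 * Real.pi / (W / T) ≠ 0 := by positivity
    refine mul_left_cancel₀ hcc ?_
    rw [← hp]
    ring

/-- Differentiating `F f = μ f` twice gives `μ f'' = F((iκt)² f)`. Moving `F` onto the other factor
`f` yields the same `μ`, which cancels. With the previous lemma the integral equals `-g ‖f'‖²`. -/
lemma integral_deriv_deriv_mul (hW : 0 < W) (hT : 0 < T) (h : IsProlate W T g f) :
    ∫ t in (-T)..T, f t * deriv (deriv f) t =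
      -((W / T) ^ 2 * ∫ t in (-T)..T, t ^ 2 * f t ^ 2) := by
  have hc := (h.isFourierEigen hW hT).cont
  obtain ⟨μ, hμ, hn⟩ := h.exists_finFourier_eq hW hT
  have hμ0 : μ ≠ 0 := by
    intro h0
    have hπ := Real.pi_pos
    have hg := h.pos
    have : 0 < 2 * Real.pi * g / (W / T) := by positivity
    rw [h0, norm_zero, zero_pow two_ne_zero] at hn
    linarith
  have hd' : Differentiable ℝ (deriv f) :=
    ((contDiff_succ_iff_deriv (n := 1)).1
      (contDiff_infty.1 (h.contDiff hW hT) 2)).2.2.differentiable one_ne_zero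
  have hd : ∀ s, finFourier (W / T) T (fun t => I * (W / T : ℝ) * t * (I * (W / T : ℝ) * t * f t)) s
      = μ * deriv (deriv f) s := by
    intro s
    rw [← deriv_finFourier _ _ (by fun_prop), ← deriv_finFourier _ _ hc, funext hμ,
      show deriv (fun s => μ * (f s : ℂ)) = fun s => μ * ((deriv f s : ℝ) : ℂ) from funext fun s => by
        rw [deriv_const_mul_field, deriv_ofReal_comp (h.differentiable hW hT)],
      deriv_const_mul_field, deriv_ofReal_comp hd']
  have hs := integral_finFourier_mul (W / T) T
    (f := fun t => I * (W / T : ℝ) * t * (I * (W / T : ℝ) * t * f t)) (by fun_prop) hc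
  simp_rw [hd, hμ] at hs
  have e1 : ∫ t in (-T)..T, μ * ((deriv (deriv f) t : ℝ) : ℂ) * f t =
      μ * ((∫ t in (-T)..T, f t * deriv (deriv f) t : ℝ) : ℂ) := by
    rw [← intervalIntegral.integral_ofReal, ← intervalIntegral.integral_const_mul]
    congr 1; ext t; push_cast; ring
  have e2 : ∫ t in (-T)..T, I * (W / T : ℝ) * t * (I * (W / T : ℝ) * t * f t) * (μ * f t) =
      μ * ((-((W / T) ^ 2 * ∫ t in (-T)..T, t ^ 2 * f t ^ 2) : ℝ) : ℂ) := by
    rw [← intervalIntegral.integral_const_mul, ← intervalIntegral.integral_neg,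
      ← intervalIntegral.integral_ofReal, ← intervalIntegral.integral_const_mul]
    congr 1; ext t; push_cast
    ring_nf
    simp only [I_sq]
    ring
  rw [e1, e2] at hs
  exact_mod_cast mul_left_cancel₀ hμ0 hs

/-- The energy of the derivative of a prolate on the interval of concentration. -/
lemma integral_deriv_sq (hW : 0 < W) (hT : 0 < T) (h : IsProlate W T g f) :
    ∫ t in (-T)..T, deriv f t ^ 2 =
      g * (∫ t, deriv f t ^ 2) + spheroidalEigenvalue W T f / T * f T ^ 2 := by
  have h2 := contDiff_infty.1 (h.contDiff hW hT) 2
  have hd1 := ((contDiff_succ_iff_deriv (n := 1)).1 h2).2.2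
  have hc1 : Continuous (deriv f) := hd1.continuous
  have hc2 : Continuous (deriv (deriv f)) := hd1.continuous_deriv le_rfl
  have hibp := intervalIntegral.integral_mul_deriv_eq_deriv_mul (a := -T) (b := T)
    (fun t _ => (h.differentiable hW hT t).hasDerivAt)
    (fun t _ => (hd1.differentiable one_ne_zero t).hasDerivAt)
    (hc1.intervalIntegrable _ _) (hc2.intervalIntegrable _ _)
  rw [h.integral_deriv_deriv_mul hW hT, ← (h.memLp_deriv_and_integral hW hT).2] at hibp
  simp_rw [← sq] at hibp
  have e1 := h.spheroidalOp_eq hW hT T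
  have e2 := h.spheroidalOp_eq hW hT (-T)
  simp only [spheroidalOp] at e1 e2
  -- At `±T` the leading coefficient vanishes and the differential equation becomes `±2T f'(±T) = λ
  -- f(±T)`.
  have e3 : f T * deriv f T = spheroidalEigenvalue W T f / (2 * T) * f T ^ 2 := by
    field_simp
    linear_combination (-f T) * e1
  have e4 : f (-T) * deriv f (-T) = -(spheroidalEigenvalue W T f / (2 * T) * f T ^ 2) := by
    rw [← h.sq_neg hW hT T]
    field_simp
    linear_combination (f (-T)) * e2
  rw [e3, e4] at hibp
  have : spheroidalEigenvalue W T f / T * f T ^ 2 =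
    2 * (spheroidalEigenvalue W T f / (2 * T) * f T ^ 2) := by field_simp
  rw [this]
  linarith

lemma le_one (hW : 0 < W) (hT : 0 < T) (h : IsProlate W T g f) : 0 ≤ 1 - g := by
  have h1 := integral_eq_interval_add_two_mul_Ioi h.memLp.integrable_sq (h.sq_neg hW hT) T
  rw [h.norm_one, h.integral_sq hW hT] at h1
  have h2 : 0 ≤ ∫ t in Ioi T, f t ^ 2 := integral_nonneg fun t => sq_nonneg _
  linarith

/-- Outside of its interval of concentration, a prolate is controlled by `C_extra`. -/
lemma sq_le_cExtra (hW : 0 < W) (hT : 0 < T) (h : IsProlate W T g f) {s : ℝ} (hs : T ≤ |s|) :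
    f s ^ 2 ≤ (1 - g) * cExtra W T g f := by
  have habs : f s ^ 2 = f |s| ^ 2 := by
    rcases abs_choice s with h1 | h1 <;> rw [h1]
    rw [h.sq_neg hW hT]
  obtain ⟨hm, -⟩ := h.memLp_deriv_and_integral hW hT
  have h1 := integral_eq_interval_add_two_mul_Ioi h.memLp.integrable_sq (h.sq_neg hW hT) T
  have h2 := integral_eq_interval_add_two_mul_Ioi hm.integrable_sq (h.deriv_sq_neg hW hT) T
  rw [h.norm_one, h.integral_sq hW hT] at h1
  have h3 := h.integral_deriv_sq hW hT
  have hA := sq_le_of_hasDerivAt_of_memLp (fun t => (h.differentiable hW hT t).hasDerivAt)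
    h.memLp hm hs
  set K := ∫ t in Ioi T, f t ^ 2
  set J := ∫ t in Ioi T, deriv f t ^ 2
  have hK : 0 ≤ K := integral_nonneg fun t => sq_nonneg _
  have hJ : 0 ≤ J := integral_nonneg fun t => sq_nonneg _
  rw [habs]
  refine hA.trans (le_of_eq ?_)
  unfold cExtra
  -- If `g = 1` the tail `K` vanishes and both sides are zero. Otherwise `2K = 1 - g` and `C_extra²
  -- = 2J / (1 - g)`, so Agmon's bound `2√K √J` equals `(1 - g) C_extra` exactly.
  rcases (h.le_one hW hT).eq_or_lt with hg | hg
  · have : K = 0 := by linarith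
    rw [this, ← hg]
    simp
  · rw [← Real.sqrt_mul hK]
    have e : (∫ t, deriv f t ^ 2) - spheroidalEigenvalue W T f / T * (f T ^ 2 / (1 - g)) =
        2 * J / (1 - g) := by
      rw [eq_div_iff hg.ne', sub_mul, mul_assoc, div_mul_cancel₀ _ hg.ne']
      linarith
    rw [e, show 1 - g = 2 * K by linarith]
    have hK0 : 0 < K := by linarith
    rw [show 2 * J / (2 * K) = K * J / K ^ 2 by field_simp, Real.sqrt_div' _ (by positivity),
      Real.sqrt_sq hK]
    field_simp

/-- The dual of a prolate is a prolate with the roles of `W` and `T` exchanged. -/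
lemma dual (hW : 0 < W) (hT : 0 < T) (h : IsProlate W T g f) :
    IsProlate T W g (dual W T f) := by
  have hr : 0 < T / W := by positivity
  have hc : Continuous f := (h.contDiff hW hT).continuous
  have hsq : ∀ w, PFD.dual W T f w ^ 2 = T / W * f (T / W * w) ^ 2 := by
    intro w
    rw [PFD.dual, mul_pow, Real.sq_sqrt hr.le]
  refine ⟨?_, fun s => ?_, h.pos, ?_⟩
  · refine (memLp_two_iff_integrable_sq ?_).2 ?_
    · unfold PFD.dual
      exact Continuous.aestronglyMeasurable (by fun_prop)
    · simp_rw [hsq]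
      exact (h.memLp.integrable_sq.comp_mul_left' hr.ne').const_mul _
  · have := h.eigen (T / W * s)
    unfold PFD.dual
    rw [show g * (√(T / W) * f (T / W * s)) = √(T / W) * (g * f (T / W * s)) by ring, ← this,
      ← intervalIntegral.integral_const_mul]
    have hcv := intervalIntegral.mul_integral_comp_mul_left (a := -W) (b := W) (c := T / W)
      (f := fun t => √(T / W) * (rho W (T / W * s - t) * f t))
    rw [mul_neg, div_mul_cancel₀ T hW.ne'] at hcv
    rw [← hcv, ← intervalIntegral.integral_const_mul]
    congr 1; ext t
    have : rho T (s - t) = T / W * rho W (T / W * s - T / W * t) := by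
      unfold rho
      rw [show W * (T / W * s - T / W * t) = T * (s - t) by field_simp]
      field_simp
    rw [this]
    ring
  · simp_rw [hsq]
    rw [integral_const_mul, Measure.integral_comp_mul_left (fun x => f x ^ 2), h.norm_one,
      abs_of_pos (by positivity), smul_eq_mul]
    field_simp

end IsProlate

end PFD

end

/-! ### Filter amplitudes and rank-one expansions of the two matrices. -/

noncomputable section

namespace PFD

open Complex Set Filter Topology

/-- Dominated convergence needs a countable index set, whereas `ι` is arbitrary. The support of the
summable majorant is countable, and off it the terms vanish on the interval. -/
lemma hasSum_intervalIntegral_of_norm_le {ι : Type*} {F : ι → ℝ → ℂ} {c : ι → ℝ} {a b : ℝ}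
    (hF : ∀ k, Continuous (F k)) (hb : ∀ k, ∀ t ∈ uIcc a b, ‖F k t‖ ≤ c k) (hc : Summable c) :
    HasSum (fun k => ∫ t in a..b, F k t) (∫ t in a..b, ∑' k, F k t) := by
  have hsupp := hc.countable_support
  have hzero : ∀ k ∉ Function.support c, ∀ t ∈ uIcc a b, F k t = 0 := by
    intro k hk t ht
    have := hb k t ht
    rw [Function.notMem_support.1 hk] at this
    exact norm_le_zero_iff.1 this
  have hcount : Countable (Function.support c) := hsupp
  have h1 : HasSum (fun k : Function.support c => ∫ t in a..b, F k t)
      (∫ t in a..b, ∑' k, F k t) := by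
    refine intervalIntegral.hasSum_integral_of_dominated_convergence (fun k _ => c k)
      (fun k => (hF k).aestronglyMeasurable)
      (fun k => Eventually.of_forall fun t ht => hb k t (uIoc_subset_uIcc ht))
      (Eventually.of_forall fun t _ => hc.subtype _) intervalIntegrable_const
      (Eventually.of_forall fun t ht => ?_)
    have ht' := uIoc_subset_uIcc ht
    have hs : Summable fun k => F k t := Summable.of_norm_bounded hc fun k => hb k t ht'
    refine (hasSum_subtype_iff_of_support_subset ?_).2 hs.hasSum
    intro k hk
    by_contra hk'
    exact hk (hzero k hk' t ht')
  refine (hasSum_subtype_iff_of_support_subset ?_).1 h1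
  intro k hk
  by_contra hk'
  refine hk ?_
  simp only
  rw [intervalIntegral.integral_congr (g := fun _ => 0) (fun t ht => hzero k hk' t ht),
    intervalIntegral.integral_zero]

/-- The transform at frequency `w - ωs` of the filter function `f`. -/
def filterAmp (T ωs : ℝ) (f : ℝ → ℝ) (w : ℝ) : ℂ :=
  finFourier 1 T (fun t => (f t : ℂ)) (w - ωs)

lemma finFourier_rescale {κ : ℝ} (hκ : κ ≠ 0) (T : ℝ) (f : ℝ → ℂ) (w : ℝ) :
    finFourier 1 T f w = finFourier κ T f (κ⁻¹ * w) := by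
  unfold finFourier
  rw [mul_inv_cancel_left₀ hκ, one_mul]

lemma IsProlate.norm_filterAmp_sq {W T g : ℝ} {f : ℝ → ℝ} (hW : 0 < W) (hT : 0 < T)
    (h : IsProlate W T g f) (ωs w : ℝ) :
    ‖filterAmp T ωs f w‖ ^ 2 = 2 * Real.pi * g * PFD.dual W T f (w - ωs) ^ 2 := by
  have hκ : W / T ≠ 0 := by positivity
  rw [filterAmp, finFourier_rescale hκ, h.norm_finFourier_sq hW hT, PFD.dual, mul_pow,
    Real.sq_sqrt (by positivity), inv_div]
  field_simp

lemma IsProlate.norm_filterAmp_sq_le {W T g : ℝ} {f : ℝ → ℝ} (hW : 0 < W) (hT : 0 < T)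
    (h : IsProlate W T g f) {ωs w : ℝ} (hw : W ≤ |w - ωs|) :
    ‖filterAmp T ωs f w‖ ^ 2 ≤ 2 * Real.pi * (g * (1 - g) * cExtra T W g (PFD.dual W T f)) := by
  rw [h.norm_filterAmp_sq hW hT]
  have h1 := (h.dual hW hT).sq_le_cExtra hT hW hw
  have hg := h.pos
  have hp := Real.pi_pos
  calc 2 * Real.pi * g * PFD.dual W T f (w - ωs) ^ 2
      ≤ 2 * Real.pi * g * ((1 - g) * cExtra T W g (PFD.dual W T f)) := by gcongr
    _ = _ := by ring

/-- This is the origin of `ε̃_M`: it bounds `‖v_k‖²` for every frequency outside the band. -/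
lemma IsProlateSequence.sum_norm_filterAmp_sq_le {W T : ℝ} {γ : ℕ → ℝ} {ξ : ℕ → ℝ → ℝ}
    (h : IsProlateSequence W T γ ξ) (hW : 0 < W) (hT : 0 < T) (M : ℕ) {ωs w : ℝ}
    (hw : W ≤ |w - ωs|) :
    ∑ l : Fin M, ‖filterAmp T ωs (ξ l) w‖ ^ 2 ≤ epsTilde W T γ ξ M := by
  rw [Fin.sum_univ_eq_sum_range (fun l => ‖filterAmp T ωs (ξ l) w‖ ^ 2) M, epsTilde,
    Finset.mul_sum]
  exact Finset.sum_le_sum fun l _ => (h.isProlate l).norm_filterAmp_sq_le hW hT hw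

lemma IsProlateSequence.epsTilde_nonneg {W T : ℝ} {γ : ℕ → ℝ} {ξ : ℕ → ℝ → ℝ}
    (h : IsProlateSequence W T γ ξ) (hW : 0 < W) (hT : 0 < T) (M : ℕ) :
    0 ≤ epsTilde W T γ ξ M := by
  refine le_trans (Finset.sum_nonneg fun l _ => sq_nonneg _)
    (h.sum_norm_filterAmp_sq_le hW hT M (ωs := 0) (w := W) ?_)
  rw [sub_zero]
  exact le_abs_self W

/-- Filtering an almost periodic signal in both variables separates the frequencies. -/
lemma hasSum_filtered {ι : Type*} {q ω : ι → ℝ} (hq : Summable fun k => |q k|) {T : ℝ}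
    (hT : 0 ≤ T) (ωs : ℝ) {f g : ℝ → ℝ} (hf : Continuous f) (hg : Continuous g) :
    HasSum (fun k => (q k : ℂ) * filterAmp T ωs f (ω k) * (starRingEnd ℂ) (filterAmp T ωs g (ω k)))
      (∫ t in (-T)..T, ∫ τ in (-T)..T, cexp (-I * ωs * (τ - t)) * f τ * g t *
        ∑' k, (q k : ℂ) * cexp (I * ω k * (τ - t : ℝ))) := by
  obtain ⟨B, hB⟩ := (isCompact_uIcc (a := -T) (b := T)).exists_bound_of_continuousOn hf.continuousOn
  obtain ⟨D, hD⟩ := (isCompact_uIcc (a := -T) (b := T)).exists_bound_of_continuousOn hg.continuousOn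
  have hTm : -T ∈ uIcc (-T) T := left_mem_uIcc
  have hB0 : 0 ≤ B := (norm_nonneg _).trans (hB _ hTm)
  have hD0 : 0 ≤ D := (norm_nonneg _).trans (hD _ hTm)
  have hker : ∀ w τ : ℝ, ‖cexp ((1 * w * τ : ℝ) * I)‖ = 1 := fun w τ => norm_exp_ofReal_mul_I _
  -- The exponential of `τ - t` factors into a function of `τ` and one of `t`, which makes each
  -- frequency contribute a rank-one term.
  have split : ∀ t τ : ℝ, ∀ k, cexp (-I * ωs * (τ - t)) * f τ * g t *
      ((q k : ℂ) * cexp (I * ω k * (τ - t : ℝ))) =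
      (q k : ℂ) * (cexp ((1 * (ω k - ωs) * τ : ℝ) * I) * f τ) *
        (cexp ((1 * -(ω k - ωs) * t : ℝ) * I) * g t) := by
    intro t τ k
    have : cexp (-I * ωs * (τ - t)) * cexp (I * ω k * (τ - t : ℝ)) =
        cexp ((1 * (ω k - ωs) * τ : ℝ) * I) * cexp ((1 * -(ω k - ωs) * t : ℝ) * I) := by
      rw [← Complex.exp_add, ← Complex.exp_add]
      congr 1
      push_cast; ring
    linear_combination ((q k : ℂ) * f τ * g t) * this
  have inner : ∀ t ∈ uIcc (-T) T, ∫ τ in (-T)..T, cexp (-I * ωs * (τ - t)) * f τ * g t *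
        ∑' k, (q k : ℂ) * cexp (I * ω k * (τ - t : ℝ)) =
      ∑' k, (q k : ℂ) * filterAmp T ωs f (ω k) *
        (cexp ((1 * -(ω k - ωs) * t : ℝ) * I) * g t) := by
    intro t ht
    have h := hasSum_intervalIntegral_of_norm_le (a := -T) (b := T) (c := fun k => |q k| * (B * D))
      (F := fun k τ => (q k : ℂ) * (cexp ((1 * (ω k - ωs) * τ : ℝ) * I) * f τ) *
        (cexp ((1 * -(ω k - ωs) * t : ℝ) * I) * g t))
      (fun k => by fun_prop) (fun k τ hτ => by
        rw [norm_mul, norm_mul, norm_mul, norm_mul, hker, hker, one_mul, one_mul, norm_real,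
          Real.norm_eq_abs, norm_real, norm_real, mul_assoc]
        gcongr
        · exact hB τ hτ
        · exact hD t ht) (hq.mul_right _)
    have e : ∀ k, ∫ τ in (-T)..T, (q k : ℂ) * (cexp ((1 * (ω k - ωs) * τ : ℝ) * I) * f τ) *
        (cexp ((1 * -(ω k - ωs) * t : ℝ) * I) * g t) = (q k : ℂ) * filterAmp T ωs f (ω k) *
        (cexp ((1 * -(ω k - ωs) * t : ℝ) * I) * g t) := by
      intro k
      rw [intervalIntegral.integral_mul_const, intervalIntegral.integral_const_mul]
      rfl
    simp_rw [e] at h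
    rw [h.tsum_eq]
    congr 1; ext τ
    rw [← tsum_mul_left]
    exact tsum_congr fun k => split t τ k
  rw [intervalIntegral.integral_congr inner]
  have h := hasSum_intervalIntegral_of_norm_le (a := -T) (b := T)
    (c := fun k => |q k| * (B * (2 * T) * D))
    (F := fun k t => (q k : ℂ) * filterAmp T ωs f (ω k) *
      (cexp ((1 * -(ω k - ωs) * t : ℝ) * I) * g t))
    (fun k => by fun_prop) (fun k t ht => by
      rw [norm_mul, norm_mul, norm_mul, hker, one_mul, norm_real, norm_real,
        Real.norm_eq_abs, mul_assoc]
      gcongr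
      · refine norm_finFourier_le 1 hT (fun τ hτ => ?_) _
        rw [norm_real]
        exact hB τ (by rwa [uIcc_of_le (by linarith)])
      · exact hD t ht) (hq.mul_right _)
  convert! h using 1
  ext k
  rw [intervalIntegral.integral_const_mul, filterAmp, filterAmp, conj_finFourier_ofReal 1 hT]
  rfl

lemma hasSum_gramMatrix {ι : Type*} {a : ι → ℂ} {ω : ι → ℝ} (ha : Summable fun k => ‖a k‖ ^ 2)
    {T : ℝ} (hT : 0 ≤ T) (ωs : ℝ) {ξ : ℕ → ℝ → ℝ} (hξ : ∀ n, Continuous (ξ n)) {M : ℕ}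
    (s l : Fin M) :
    HasSum (fun k => ((‖a k‖ ^ 2 : ℝ) : ℂ) * filterAmp T ωs (ξ s) (ω k) *
      (starRingEnd ℂ) (filterAmp T ωs (ξ l) (ω k))) (gramMatrix T ωs ξ (signal a ω) M s l) :=
  hasSum_filtered (q := fun k => ‖a k‖ ^ 2) ha.abs hT ωs (hξ s) (hξ l)

lemma deriv_signal_sub {ι : Type*} {a : ι → ℂ} {ω : ι → ℝ} (ha : Summable fun k => ‖a k‖ ^ 2)
    (haω : Summable fun k => |ω k| * ‖a k‖ ^ 2) (τ t : ℝ) :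
    deriv (fun u : ℝ => signal a ω (τ - u)) t =
      -I * ∑' k, ((ω k * ‖a k‖ ^ 2 : ℝ) : ℂ) * cexp (I * ω k * (τ - t : ℝ)) := by
  have hn : ∀ (k : ι) (u : ℝ), ‖cexp (I * ω k * (τ - u : ℝ))‖ = 1 := by
    intro k u
    rw [show I * ω k * ((τ - u : ℝ) : ℂ) = ((ω k * (τ - u) : ℝ) : ℂ) * I by push_cast; ring,
      norm_exp_ofReal_mul_I]
  have hd : ∀ (k : ι) (u : ℝ), HasDerivAt
      (fun u : ℝ => ((‖a k‖ ^ 2 : ℝ) : ℂ) * cexp (I * ω k * (τ - u : ℝ)))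
      (-I * (((ω k * ‖a k‖ ^ 2 : ℝ) : ℂ) * cexp (I * ω k * (τ - u : ℝ)))) u := by
    intro k u
    have h1 : HasDerivAt (fun u : ℝ => I * ω k * ((τ - u : ℝ) : ℂ)) (I * ω k * ((-1 : ℝ) : ℂ)) u :=
      (((hasDerivAt_id u).const_sub τ).ofReal_comp).const_mul _
    convert! h1.cexp.const_mul (((‖a k‖ ^ 2 : ℝ) : ℂ)) using 1
    push_cast; ring
  have := hasDerivAt_tsum (u := fun k => |ω k| * ‖a k‖ ^ 2) haω hd (fun k u => by
    rw [norm_mul, norm_mul, hn, norm_neg, norm_I, one_mul, mul_one, norm_real, Real.norm_eq_abs,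
      abs_mul, abs_of_nonneg (sq_nonneg ‖a k‖)]) (y₀ := t)
    (Summable.of_norm_bounded ha fun k => by
      rw [norm_mul, hn, mul_one, norm_real, Real.norm_eq_abs, abs_of_nonneg (sq_nonneg ‖a k‖)]) t
  rw [← tsum_mul_left]
  exact this.deriv

/-- Differentiating in `t` brings out `-iω_k`, and the prefactor `i` turns this into the real weight
`ω_k`. The vectors are those of the Gram matrix. -/
lemma hasSum_hamMatrix {ι : Type*} {a : ι → ℂ} {ω : ι → ℝ} (ha : Summable fun k => ‖a k‖ ^ 2)
    (haω : Summable fun k => |ω k| * ‖a k‖ ^ 2)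
    {T : ℝ} (hT : 0 ≤ T) (ωs : ℝ) {ξ : ℕ → ℝ → ℝ} (hξ : ∀ n, Continuous (ξ n)) {M : ℕ}
    (s l : Fin M) :
    HasSum (fun k => ((ω k * ‖a k‖ ^ 2 : ℝ) : ℂ) * filterAmp T ωs (ξ s) (ω k) *
      (starRingEnd ℂ) (filterAmp T ωs (ξ l) (ω k))) (hamMatrix T ωs ξ (signal a ω) M s l) := by
  have hq : Summable fun k => |ω k * ‖a k‖ ^ 2| := by
    simpa only [abs_mul, abs_of_nonneg (sq_nonneg ‖_‖)] using haω
  have h := hasSum_filtered (q := fun k => ω k * ‖a k‖ ^ 2) (ω := ω) hq hT ωs (hξ s) (hξ l)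
  convert! h using 1
  simp only [hamMatrix, Matrix.of_apply, deriv_signal_sub ha haω]
  rw [← intervalIntegral.integral_const_mul]
  congr 1; ext t
  rw [← intervalIntegral.integral_const_mul]
  congr 1; ext τ
  linear_combination (-(cexp (-I * ωs * (τ - t)) * ξ s τ * ξ l t *
    ∑' k, ((ω k * ‖a k‖ ^ 2 : ℝ) : ℂ) * cexp (I * ω k * (τ - t : ℝ)))) * I_sq

lemma signal_zero_re {ι : Type*} (a : ι → ℂ) (ω : ι → ℝ) :
    (signal a ω 0).re = ∑' k, ‖a k‖ ^ 2 := by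
  have : signal a ω 0 = ((∑' k, ‖a k‖ ^ 2 : ℝ) : ℂ) := by
    rw [ofReal_tsum]
    simp [signal]
  rw [this, ofReal_re]

end PFD

end

/-! ### Minimax comparison for the generalized eigenvalue problem. -/

noncomputable section

namespace PFD

open Complex Matrix

/-- There are `(m - |J|) + |K| < m` linear conditions on `m` coordinates. -/
lemma exists_ne_zero_vanishing {m : ℕ} (J K : Finset (Fin m)) (hJK : K.card < J.card)
    (b : Fin m → (Fin m → ℂ) →ₗ[ℂ] ℂ) :
    ∃ c : Fin m → ℂ, c ≠ 0 ∧ (∀ j ∉ J, c j = 0) ∧ ∀ k ∈ K, b k c = 0 := by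
  let F : (Fin m → ℂ) →ₗ[ℂ] ((↥Jᶜ ⊕ ↥K) → ℂ) :=
    LinearMap.pi (Sum.elim (fun j => LinearMap.proj j.1) (fun k => b k.1))
  have hlt : Module.finrank ℂ ((↥Jᶜ ⊕ ↥K) → ℂ) < Module.finrank ℂ (Fin m → ℂ) := by
    simp only [Module.finrank_fintype_fun_eq_card, Fintype.card_sum, Fintype.card_coe,
      Finset.card_compl, Fintype.card_fin]
    have : J.card ≤ m := by simpa using Finset.card_le_univ J
    omega
  obtain ⟨c, hc, hc0⟩ := (Submodule.ne_bot_iff _).1 (LinearMap.ker_ne_bot_of_finrank_lt hlt (f := F))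
  have hF : ∀ x, F c x = 0 := fun x => congrFun (LinearMap.mem_ker.1 hc) x
  refine ⟨c, hc0, fun j hj => ?_, fun k hk => ?_⟩
  · exact hF (Sum.inl ⟨j, Finset.mem_compl.2 hj⟩)
  · exact hF (Sum.inr ⟨k, hk⟩)

lemma star_mulVec_dotProduct_mulVec {m n : Type*} [Fintype m] [Fintype n]
    (N : Matrix m n ℂ) (X : Matrix m m ℂ) (x : n → ℂ) :
    star (N *ᵥ x) ⬝ᵥ (X *ᵥ (N *ᵥ x)) = star x ⬝ᵥ ((Nᴴ * X * N) *ᵥ x) := by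
  rw [star_mulVec, ← dotProduct_mulVec, mulVec_mulVec, mulVec_mulVec, Matrix.mul_assoc]

lemma star_dotProduct_diagonal_mulVec {m : Type*} [Fintype m] [DecidableEq m] (d : m → ℝ)
    (x : m → ℂ) :
    star x ⬝ᵥ (diagonal (fun i => (d i : ℂ)) *ᵥ x) = ((∑ i, d i * ‖x i‖ ^ 2 : ℝ) : ℂ) := by
  simp only [dotProduct, mulVec_diagonal, Pi.star_apply, RCLike.star_def]
  push_cast
  refine Finset.sum_congr rfl fun i _ => ?_
  rw [← conj_mul']
  ring

lemma star_dotProduct_self {m : Type*} [Fintype m] (x : m → ℂ) :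
    star x ⬝ᵥ x = ((∑ i, ‖x i‖ ^ 2 : ℝ) : ℂ) := by
  simp only [dotProduct, Pi.star_apply, RCLike.star_def, conj_mul']
  push_cast
  rfl

lemma norm_sq_star_dotProduct_le {m : Type*} [Fintype m] (x y : m → ℂ) :
    ‖star x ⬝ᵥ y‖ ^ 2 ≤ (∑ i, ‖x i‖ ^ 2) * ∑ i, ‖y i‖ ^ 2 := by
  have h1 : ‖star x ⬝ᵥ y‖ ≤ ∑ i, ‖x i‖ * ‖y i‖ := by
    refine (norm_sum_le _ _).trans (le_of_eq ?_)
    simp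
  calc _ ≤ (∑ i, ‖x i‖ * ‖y i‖) ^ 2 := by gcongr
    _ ≤ _ := Finset.sum_mul_sq_le_sq_mul_sq _ _ _

/-- The quadratic form of a sum of rank-one matrices. -/
lemma hasSum_quadraticForm {ι m : Type*} [Fintype m] {q : ι → ℝ} {v : ι → m → ℂ}
    {X : Matrix m m ℂ}
    (hX : ∀ s l, HasSum (fun k => (q k : ℂ) * v k s * (starRingEnd ℂ) (v k l)) (X s l))
    (y : m → ℂ) {r : ℝ} (hr : star y ⬝ᵥ (X *ᵥ y) = r) :
    HasSum (fun k => q k * ‖star (v k) ⬝ᵥ y‖ ^ 2) r := by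
  rw [← Complex.hasSum_ofReal, ← hr]
  have h : HasSum (fun k => ∑ s, ∑ l, (starRingEnd ℂ) (y s) *
      ((q k : ℂ) * v k s * (starRingEnd ℂ) (v k l) * y l)) (star y ⬝ᵥ (X *ᵥ y)) := by
    simp only [dotProduct, mulVec, Finset.mul_sum, Pi.star_apply, RCLike.star_def]
    exact hasSum_sum fun s _ => hasSum_sum fun l _ => ((hX s l).mul_right _).mul_left _
  convert! h using 1
  ext k
  push_cast
  rw [← conj_mul']
  simp only [dotProduct, map_sum, map_mul, Pi.star_apply, RCLike.star_def, conj_conj]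
  rw [Finset.sum_mul_sum, Finset.mul_sum]
  refine Finset.sum_congr rfl fun s _ => ?_
  rw [Finset.mul_sum]
  refine Finset.sum_congr rfl fun l _ => ?_
  ring

lemma le_mul_div_of_mul_le {d N L X ε S : ℝ} (hN : 0 < N) (hL : 0 < L) (hε : 0 ≤ ε)
    (hS : 0 ≤ S) (hX : L * X ≤ N) (h : d * N ≤ ε * S * X) : d ≤ ε * S / L := by
  have h1 : 0 ≤ ε * S := mul_nonneg hε hS
  rw [le_div_iff₀ hL]
  refine le_of_mul_le_mul_right ?_ hN
  nlinarith [mul_le_mul_of_nonneg_left hX h1, mul_le_mul_of_nonneg_left h hL.le]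

section Minimax

variable {ι : Type*} {m M : ℕ} {p ω : ι → ℝ} {v : ι → Fin M → ℂ}
  {V H : Matrix (Fin M) (Fin M) ℂ} {N : Matrix (Fin M) (Fin m) ℂ}
  {d μ : Fin m → ℝ} {L : ℝ} {Φ : Matrix (Fin m) (Fin m) ℂ}

/-- Test vectors for the generalized eigenvalue problem `(N† H N) x = μ (N† V N) x`: they lie in
the span of the eigenvectors with index in `J` and are orthogonal to the `v (idx k)`, `k ∈ K`. -/
lemma exists_test_vector
    (hV : ∀ s l, HasSum (fun k => (p k : ℂ) * v k s * (starRingEnd ℂ) (v k l)) (V s l))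
    (hH : ∀ s l, HasSum (fun k => ((ω k * p k : ℝ) : ℂ) * v k s * (starRingEnd ℂ) (v k l)) (H s l))
    (hN : Nᴴ * N = 1) (hL : ∀ i, L ≤ d i) (hB : Nᴴ * V * N = diagonal fun i => (d i : ℂ))
    (hΦ : Φᴴ * (diagonal fun i => (d i : ℂ)) * Φ = 1)
    (hA : Nᴴ * H * N * Φ = (diagonal fun i => (d i : ℂ)) * Φ * diagonal fun i => (μ i : ℂ))
    (idx : Fin m → ι) (J K : Finset (Fin m)) (hJK : K.card < J.card) :
    ∃ (c : Fin m → ℝ) (β : ι → ℝ) (X : ℝ), (∀ j, 0 ≤ c j) ∧ 0 < ∑ j, c j ∧ (∀ j ∉ J, c j = 0) ∧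
      (∀ k, 0 ≤ β k) ∧ (∀ j ∈ K, β (idx j) = 0) ∧ (∀ k, β k ≤ (∑ l, ‖v k l‖ ^ 2) * X) ∧
      L * X ≤ ∑ j, c j ∧ 0 ≤ X ∧ HasSum (fun k => p k * β k) (∑ j, c j) ∧
      HasSum (fun k => ω k * p k * β k) (∑ j, μ j * c j) := by
  let b : Fin m → (Fin m → ℂ) →ₗ[ℂ] ℂ := fun j =>
    { toFun := fun c => star (v (idx j)) ⬝ᵥ (N *ᵥ (Φ *ᵥ c))
      map_add' := fun x y => by simp only [mulVec_add, dotProduct_add]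
      map_smul' := fun r x => by simp only [mulVec_smul, dotProduct_smul, RingHom.id_apply] }
  obtain ⟨c, hc0, hcJ, hcK⟩ := exists_ne_zero_vanishing J K hJK b
  have qB : star (Φ *ᵥ c) ⬝ᵥ ((Nᴴ * V * N) *ᵥ (Φ *ᵥ c)) = ((∑ j, ‖c j‖ ^ 2 : ℝ) : ℂ) := by
    rw [star_mulVec_dotProduct_mulVec, hB, hΦ, one_mulVec, star_dotProduct_self]
  have qA : star (Φ *ᵥ c) ⬝ᵥ ((Nᴴ * H * N) *ᵥ (Φ *ᵥ c)) =
      ((∑ j, μ j * ‖c j‖ ^ 2 : ℝ) : ℂ) := by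
    rw [star_mulVec_dotProduct_mulVec, Matrix.mul_assoc, hA, ← Matrix.mul_assoc,
      ← Matrix.mul_assoc, hΦ, Matrix.one_mul, star_dotProduct_diagonal_mulVec]
  have hnorm : ∑ l, ‖(N *ᵥ (Φ *ᵥ c)) l‖ ^ 2 = ∑ j, ‖(Φ *ᵥ c) j‖ ^ 2 := by
    have h1 := star_mulVec_dotProduct_mulVec N 1 (Φ *ᵥ c)
    rw [one_mulVec, Matrix.mul_one, hN, one_mulVec, star_dotProduct_self,
      star_dotProduct_self] at h1
    exact_mod_cast h1
  have hd : ∑ j, d j * ‖(Φ *ᵥ c) j‖ ^ 2 = ∑ j, ‖c j‖ ^ 2 := by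
    rw [hB, star_dotProduct_diagonal_mulVec] at qB
    exact_mod_cast qB
  -- With `y = NΦc`, the witnesses are `|c_j|²`, `β_k = |v_k† y|²` and `X = ‖y‖² = ‖Φc‖²`, as `N` is
  -- an isometry. The normalization of `Φ` makes `y† V y = ∑ |c_j|²`, and `d ≥ L` bounds this below
  -- by `L X`.
  refine ⟨fun j => ‖c j‖ ^ 2, fun k => ‖star (v k) ⬝ᵥ (N *ᵥ (Φ *ᵥ c))‖ ^ 2,
    ∑ j, ‖(Φ *ᵥ c) j‖ ^ 2, fun j => sq_nonneg _, ?_, fun j hj => ?_, fun k => sq_nonneg _,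
    fun j hj => ?_, fun k => ?_, ?_, Finset.sum_nonneg fun j _ => sq_nonneg _, ?_, ?_⟩
  · obtain ⟨j, hj⟩ := Function.ne_iff.1 hc0
    exact Finset.sum_pos' (fun j _ => sq_nonneg _)
      ⟨j, Finset.mem_univ j, pow_pos (norm_pos_iff.2 hj) 2⟩
  · simp [hcJ j hj]
  · have : star (v (idx j)) ⬝ᵥ (N *ᵥ (Φ *ᵥ c)) = 0 := hcK j hj
    simp only [this, norm_zero, zero_pow two_ne_zero]
  · rw [← hnorm]
    exact norm_sq_star_dotProduct_le _ _
  · rw [← hd, Finset.mul_sum]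
    exact Finset.sum_le_sum fun j _ => mul_le_mul_of_nonneg_right (hL j) (sq_nonneg _)
  · exact hasSum_quadraticForm hV _ (by rw [star_mulVec_dotProduct_mulVec, qB])
  · exact hasSum_quadraticForm hH _ (by rw [star_mulVec_dotProduct_mulVec, qA])

/-- With `z = ω (idx i)`, a test vector turns the Rayleigh quotient minus `z` into a sum of terms
`(ω_k - z) p_k β_k`. Choosing `J` one larger than `K` puts the quotient on the right side of `μ i`
and removes the band terms of the wrong sign; the remaining wrong-signed terms lie on one side of
the band and satisfy `β_k ≤ ε X`. -/
lemma gep_eigenvalue_sub_le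
    (hp : ∀ k, 0 ≤ p k) (hps : Summable p) (hpω : Summable fun k => |ω k| * p k)
    (hV : ∀ s l, HasSum (fun k => (p k : ℂ) * v k s * (starRingEnd ℂ) (v k l)) (V s l))
    (hH : ∀ s l, HasSum (fun k => ((ω k * p k : ℝ) : ℂ) * v k s * (starRingEnd ℂ) (v k l)) (H s l))
    (hN : Nᴴ * N = 1) (hL0 : 0 < L) (hL : ∀ i, L ≤ d i)
    (hB : Nᴴ * V * N = diagonal fun i => (d i : ℂ))
    (hΦ : Φᴴ * (diagonal fun i => (d i : ℂ)) * Φ = 1)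
    (hA : Nᴴ * H * N * Φ = (diagonal fun i => (d i : ℂ)) * Φ * diagonal fun i => (μ i : ℂ))
    (hμ : Antitone μ) {idx : Fin m → ι} (hidx : StrictAnti fun i => ω (idx i)) {lo hi ε : ℝ}
    (hrange : Set.range idx = {k | ω k ∈ Set.Icc lo hi}) (hε0 : 0 ≤ ε)
    (hε : ∀ k, ω k ∉ Set.Icc lo hi → ∑ l, ‖v k l‖ ^ 2 ≤ ε) (i : Fin m) :
    ε * (∑' l : {l // ω l < lo}, (ω l - ω (idx i)) * p l) / L ≤ μ i - ω (idx i) ∧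
      μ i - ω (idx i) ≤ ε * (∑' l : {l // hi < ω l}, (ω l - ω (idx i)) * p l) / L := by
  set z := ω (idx i)
  have hz : z ∈ Set.Icc lo hi := by
    have : idx i ∈ {k | ω k ∈ Set.Icc lo hi} := hrange ▸ Set.mem_range_self i
    exact this
  have hcase : ∀ k, ω k < lo ∨ hi < ω k ∨ ∃ j, idx j = k := by
    intro k
    by_cases h1 : ω k < lo
    · exact Or.inl h1
    by_cases h2 : hi < ω k
    · exact Or.inr (Or.inl h2)
    have : k ∈ Set.range idx := hrange ▸ ⟨not_lt.1 h1, not_lt.1 h2⟩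
    exact Or.inr (Or.inr this)
  have hsum : Summable fun k => (ω k - z) * p k := by
    have h1 : Summable fun k => ω k * p k := by
      refine Summable.of_norm ?_
      simpa only [norm_mul, Real.norm_eq_abs, abs_of_nonneg (hp _)] using hpω
    simpa only [sub_mul] using h1.sub (hps.mul_left z)
  constructor
  · obtain ⟨c, β, X, hc, hc0, hcJ, hβ, hβK, hβX, hX, hX0, s1, s2⟩ :=
      -- Eigenvectors from `i` on have quotients at most `μ i`; the conditions on indices beyond `i`
      -- remove the band frequencies below `z`.
      exists_test_vector hV hH hN hL hB hΦ hA idx (Finset.Ici i) (Finset.Ioi i)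
        (by simp only [Fin.card_Ici, Fin.card_Ioi]; omega)
    have hS : 0 ≤ -∑' l : {l // ω l < lo}, (ω l - z) * p l := by
      rw [← tsum_neg]
      refine tsum_nonneg fun l => ?_
      rw [← neg_mul]
      exact mul_nonneg (by linarith [l.2, hz.1]) (hp l)
    have hgep : (μ i - z) * ∑ j, c j ≥ ∑ j, μ j * c j - z * ∑ j, c j := by
      rw [sub_mul, Finset.mul_sum]
      refine sub_le_sub_right (Finset.sum_le_sum fun j _ => ?_) _
      by_cases hj : j ∈ Finset.Ici i
      · exact mul_le_mul_of_nonneg_right (hμ (Finset.mem_Ici.1 hj)) (hc j)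
      · rw [hcJ j hj, mul_zero, mul_zero]
    have hle : ε * X * ∑' l : {l // ω l < lo}, (ω l - z) * p l ≤
        ∑ j, μ j * c j - z * ∑ j, c j := by
      have e : ∑' l : {l // ω l < lo}, (ω l - z) * p l =
          ∑' l, {l | ω l < lo}.indicator (fun l => (ω l - z) * p l) l :=
        tsum_subtype {l | ω l < lo} (fun l => (ω l - z) * p l)
      rw [e]
      refine hasSum_le (fun k => ?_) ((hsum.indicator _).hasSum.mul_left (ε * X))
        (s2.sub (s1.mul_left z))
      by_cases hk : ω k < lo
      · rw [Set.indicator_of_mem (show k ∈ {l | ω l < lo} from hk)]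
        have h1 : β k ≤ ε * X := (hβX k).trans
          (mul_le_mul_of_nonneg_right (hε k fun h => absurd h.1 (not_le.2 hk)) hX0)
        have h2 : 0 ≤ (z - ω k) * p k := mul_nonneg (by linarith [hz.1]) (hp k)
        nlinarith [mul_le_mul_of_nonneg_right h1 h2]
      · rw [Set.indicator_of_notMem (show k ∉ {l | ω l < lo} from hk), mul_zero]
        rcases hcase k with h1 | h1 | ⟨j, rfl⟩
        · exact absurd h1 hk
        · have := mul_nonneg (mul_nonneg (by linarith [hz.2] : 0 ≤ ω k - z) (hp k)) (hβ k)
          linarith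
        · by_cases hj : j ∈ Finset.Ioi i
          · simp [hβK j hj]
          · have h3 : z ≤ ω (idx j) := hidx.antitone (not_lt.1 (mt Finset.mem_Ioi.2 hj))
            have := mul_nonneg (mul_nonneg (sub_nonneg.2 h3) (hp (idx j))) (hβ (idx j))
            linarith
    have := le_mul_div_of_mul_le (d := -(μ i - z)) hc0 hL0 hε0 hS hX (by linarith)
    rw [mul_neg, neg_div] at this
    linarith
  · obtain ⟨c, β, X, hc, hc0, hcJ, hβ, hβK, hβX, hX, hX0, s1, s2⟩ :=
      exists_test_vector hV hH hN hL hB hΦ hA idx (Finset.Iic i) (Finset.Iio i)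
        (by simp only [Fin.card_Iic, Fin.card_Iio]; omega)
    have hS : 0 ≤ ∑' l : {l // hi < ω l}, (ω l - z) * p l :=
      tsum_nonneg fun l => mul_nonneg (by linarith [l.2, hz.2]) (hp l)
    have hgep : (μ i - z) * ∑ j, c j ≤ ∑ j, μ j * c j - z * ∑ j, c j := by
      rw [sub_mul, Finset.mul_sum]
      refine sub_le_sub_right (Finset.sum_le_sum fun j _ => ?_) _
      by_cases hj : j ∈ Finset.Iic i
      · exact mul_le_mul_of_nonneg_right (hμ (Finset.mem_Iic.1 hj)) (hc j)
      · rw [hcJ j hj, mul_zero, mul_zero]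
    have hle : ∑ j, μ j * c j - z * ∑ j, c j ≤
        ε * X * ∑' l : {l // hi < ω l}, (ω l - z) * p l := by
      have e : ∑' l : {l // hi < ω l}, (ω l - z) * p l =
          ∑' l, {l | hi < ω l}.indicator (fun l => (ω l - z) * p l) l :=
        tsum_subtype {l | hi < ω l} (fun l => (ω l - z) * p l)
      rw [e]
      refine hasSum_le (fun k => ?_) (s2.sub (s1.mul_left z))
        ((hsum.indicator _).hasSum.mul_left (ε * X))
      by_cases hk : hi < ω k
      · rw [Set.indicator_of_mem (show k ∈ {l | hi < ω l} from hk)]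
        have h1 : β k ≤ ε * X := (hβX k).trans
          (mul_le_mul_of_nonneg_right (hε k fun h => absurd h.2 (not_le.2 hk)) hX0)
        have h2 : 0 ≤ (ω k - z) * p k := mul_nonneg (by linarith [hz.2]) (hp k)
        nlinarith [mul_le_mul_of_nonneg_right h1 h2]
      · rw [Set.indicator_of_notMem (show k ∉ {l | hi < ω l} from hk), mul_zero]
        rcases hcase k with h1 | h1 | ⟨j, rfl⟩
        · have := mul_nonneg (mul_nonneg (by linarith [hz.1] : 0 ≤ z - ω k) (hp k)) (hβ k)
          linarith
        · exact absurd h1 hk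
        · by_cases hj : j ∈ Finset.Iio i
          · simp [hβK j hj]
          · have h3 : ω (idx j) ≤ z := hidx.antitone (not_lt.1 (mt Finset.mem_Iio.2 hj))
            have := mul_nonneg (mul_nonneg (sub_nonneg.2 h3) (hp (idx j))) (hβ (idx j))
            linarith
    exact le_mul_div_of_mul_le hc0 hL0 hε0 hS hX (by linarith)

end Minimax

end PFD

end

/-! ### The main theorem. -/

theorem mainTheorem2 {ι : Type*} (a : ι → ℂ) (ω : ι → ℝ) (hω : Function.Injective ω)
    (ha : Summable fun k => ‖a k‖ ^ 2) (haω : Summable fun k => |ω k| * ‖a k‖ ^ 2)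
    (W T ωs : ℝ) (hW : 0 < W) (hT : 0 < T)
    (γ : ℕ → ℝ) (ξ : ℕ → ℝ → ℝ) (hξ : PFD.IsProlateSequence W T γ ξ)
    -- the `m` frequencies in the band, in decreasing order
    (m : ℕ) (hm : 0 < m) (idx : Fin m → ι) (hidx : StrictAnti fun i => ω (idx i))
    (hrange : Set.range idx = {k | ω k ∈ Set.Icc (ωs - W) (ωs + W)})
    -- the refinement of the `M`-dimensional problem
    (M : ℕ) (hmM : m ≤ M) (U : Matrix (Fin M) (Fin M) ℂ) (lam : Fin M → ℝ)
    (hU : PFD.Diagonalizes (PFD.gramMatrix T ωs ξ (PFD.signal a ω) M) U lam)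
    -- the `m`-th eigenvalue of the Gram matrix lies above the noise level
    (hdetect : PFD.epsTilde W T γ ξ M * (PFD.signal a ω 0).re < lam ⟨m - 1, by omega⟩)
    (ω' : Fin m → ℝ)
    (hω' : PFD.IsGEPEigenvalues
      (PFD.refinedHam hmM U (PFD.hamMatrix T ωs ξ (PFD.signal a ω) M))
      (PFD.refinedGram hmM lam) ω')
    (i : Fin m) :
    PFD.epsTilde W T γ ξ M * (∑' l : {l // ω l < ωs - W}, (ω l - ω (idx i)) * ‖a l‖ ^ 2) /
        (lam ⟨m - 1, by omega⟩ - PFD.epsTilde W T γ ξ M * (PFD.signal a ω 0).re)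
      ≤ ω' i - ω (idx i) ∧
    ω' i - ω (idx i) ≤
      PFD.epsTilde W T γ ξ M * (∑' l : {l // ωs + W < ω l}, (ω l - ω (idx i)) * ‖a l‖ ^ 2) /
        (lam ⟨m - 1, by omega⟩ - PFD.epsTilde W T γ ξ M * (PFD.signal a ω 0).re) := by
  obtain ⟨hUu, hanti, hdiag⟩ := hU
  obtain ⟨hμ, Φ, hΦ, hA⟩ := hω'
  have hcont : ∀ n, Continuous (ξ n) := fun n => ((hξ.isProlate n).contDiff hW hT).continuous
  have hε0 := hξ.epsTilde_nonneg hW hT M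
  have hC0 : 0 ≤ (PFD.signal a ω 0).re := by
    rw [PFD.signal_zero_re]
    exact tsum_nonneg fun k => sq_nonneg _
  have hεC := mul_nonneg hε0 hC0
  have hgap : 0 < lam ⟨m - 1, by omega⟩ - PFD.epsTilde W T γ ξ M * (PFD.signal a ω 0).re :=
    sub_pos.2 hdetect
  -- The first `m` columns of `U`; compression by this isometry gives the refined matrices.
  let N : Matrix (Fin M) (Fin m) ℂ := U.submatrix id (Fin.castLE hmM)
  have hinj : Function.Injective (Fin.castLE hmM) := Fin.castLE_injective hmM
  have hcomp : ∀ X : Matrix (Fin M) (Fin M) ℂ, N.conjTranspose * X * N =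
      (U.conjTranspose * X * U).submatrix (Fin.castLE hmM) (Fin.castLE hmM) := fun X => rfl
  have hN : N.conjTranspose * N = 1 := by
    have h := hcomp 1
    rw [Matrix.mul_one, Matrix.mul_one] at h
    rw [h, ← Matrix.star_eq_conjTranspose, (Matrix.mem_unitaryGroup_iff').1 hUu,
      Matrix.submatrix_one _ hinj]
  have hB : N.conjTranspose * PFD.gramMatrix T ωs ξ (PFD.signal a ω) M * N =
      Matrix.diagonal fun i => (lam (Fin.castLE hmM i) : ℂ) := by
    rw [hcomp, hdiag, Matrix.submatrix_diagonal _ _ hinj]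
    rfl
  obtain ⟨h1, h2⟩ := PFD.gep_eigenvalue_sub_le (p := fun k => ‖a k‖ ^ 2) (ω := ω)
    (v := fun k (s : Fin M) => PFD.filterAmp T ωs (ξ s) (ω k))
    (fun k => sq_nonneg _) ha haω
    (PFD.hasSum_gramMatrix ha hT.le ωs hcont) (PFD.hasSum_hamMatrix ha haω hT.le ωs hcont)
    -- Here `L` is the `m`-th eigenvalue, at zero-based index `m - 1`; detection above the noise
    -- level makes it positive.
    hN (hεC.trans_lt hdetect)
    (fun j => hanti (Fin.le_def.2 (by simp only [Fin.val_castLE]; omega))) hB hΦ hA hμ hidx hrange hε0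
    (fun k hk => hξ.sum_norm_filterAmp_sq_le hW hT M (by
      by_contra hlt
      have := abs_lt.1 (not_le.1 hlt)
      exact hk ⟨by linarith, by linarith⟩)) i
  have hz : ω (idx i) ∈ Set.Icc (ωs - W) (ωs + W) := by
    have : idx i ∈ {k | ω k ∈ Set.Icc (ωs - W) (ωs + W)} := hrange ▸ Set.mem_range_self i
    exact this
  have hlo : ∑' l : {l // ω l < ωs - W}, (ω l - ω (idx i)) * ‖a l‖ ^ 2 ≤ 0 :=
    tsum_nonpos fun l => mul_nonpos_of_nonpos_of_nonneg (by linarith [l.2, hz.1]) (sq_nonneg _)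
  have hhi : 0 ≤ ∑' l : {l // ωs + W < ω l}, (ω l - ω (idx i)) * ‖a l‖ ^ 2 :=
    tsum_nonneg fun l => mul_nonneg (by linarith [l.2, hz.2]) (sq_nonneg _)
  -- The bounds so far have denominator `λ_m`. The two sums have definite signs, so the smaller
  -- denominator `λ_m - ε̃_M C(0)` only weakens them.
  constructor
  · refine le_trans ?_ h1
    have := div_le_div_of_nonneg_left (neg_nonneg.2 (mul_nonpos_of_nonneg_of_nonpos hε0 hlo)) hgap
      (sub_le_self _ hεC)
    rw [neg_div, neg_div] at this
    linarith
  · exact h2.trans (div_le_div_of_nonneg_left (mul_nonneg hε0 hhi) hgap (sub_le_self _ hεC))
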